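/- **Theorem 2.3.** Let $\frac12<H_1<H_2<1$. With $B$ the beta function, put $\beta_H=\Big(\frac{H(2H-1)}{B(H-\frac12,\,2-2H)}\Big)^{1/2}$ and $\gamma_H=\Big(\frac{2H(2-2H)\,\Gamma(\frac32-H)^3\,\Gamma(H+\frac12)}{\Gamma(3-2H)}\Big)^{1/2}$ for $H\in(\frac12,1)$. For $0<s<t$ let $$K_{H_1,H_2}(t,s)=\beta_{H_2}s^{\frac12-H_2}\int_s^t(t-u)^{\frac12-H_1}u^{H_2-H_1}(u-s)^{H_2-\frac32}\,du,$$ and for $s,u>0$, $s\ne u$, let $$k(s,u)=\int_0^{s\wedge u}\partial_sK_{H_1,H_2}(s,v)\,\partial_uK_{H_1,H_2}(u,v)\,dv .$$ For $T>0$ consider the integral equation $$\gamma_{H_1}^2u^{1-2H_1}=\gamma_{H_1}^2h(u)\,u^{1-2H_1}+\int_0^Th(s)\,k(s,u)\,ds,\qquad u\in(0,T].\tag{2.7}$$ If $H_2-H_1>\frac14$, then there is a sequence of positive numbers $T_n\to\infty$ such that, for every $n$, equation (2.7) with $T=T_n$ has a unique solution $h_{T_n}$ on $[0,T_n]$, and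 $\int_0^{T_n}h_{T_n}(t)^2\,t^{1-2H_1}\,dt<\infty$, that is, $h_{T_n}(t)\,t^{\frac12-H_1}\in L_2[0,T_n]$. Here $h_{T_n}$ satisfies (2.7), with an absolutely convergent integral, for every $u\in(0,T_n]$. Uniqueness means that every measurable $g$ on $[0,T_n]$ which satisfies (2.7), with an absolutely convergent integral, for almost every $u\in(0,T_n]$ equals $h_{T_n}$ almost everywhere. -/

import Mathlib

open MeasureTheory Set Filter Topology

namespace MixedFBM

noncomputable section

/-- `α_H = H (2H - 1)`. -/
def alphaH (H : ℝ) : ℝ := H * (2 * H - 1)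

/-- `β_H = (α_H / B(H - 1/2, 2 - 2H))^{1/2}`, where `B` is Euler's beta function. -/
def betaH (H : ℝ) : ℝ :=
  Real.sqrt (alphaH H / ProbabilityTheory.beta (H - 1 / 2) (2 - 2 * H))

/-- `γ_H = (2H (2 - 2H) Γ(3/2 - H)^3 Γ(H + 1/2) / Γ(3 - 2H))^{1/2}`, the constant for which the
fundamental martingale of a fractional Brownian motion is `γ_H ∫_0^t s^{1/2 - H} dW(s)`;
equivalently, `γ_H = β_H B(3/2 - H, H - 1/2)`. -/
def gammaH (H : ℝ) : ℝ :=
  Real.sqrt (2 * H * (2 - 2 * H) * Real.Gamma (3 / 2 - H) ^ 3 * Real.Gamma (H + 1 / 2) /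
    Real.Gamma (3 - 2 * H))

/-- The kernel `K_{H₁,H₂}(t,s)`, meaningful for `0 < s < t`. -/
def kernelK (H₁ H₂ t s : ℝ) : ℝ :=
  betaH H₂ * s ^ (1 / 2 - H₂) *
    ∫ u in s..t, (t - u) ^ (1 / 2 - H₁) * u ^ (H₂ - H₁) * (u - s) ^ (H₂ - 3 / 2)

/-- The partial derivative `∂_t K_{H₁,H₂}(t,s)` in the first variable. -/
def dKernelK (H₁ H₂ t s : ℝ) : ℝ := deriv (fun t' : ℝ => kernelK H₁ H₂ t' s) t

/-- The kernel `k(s,u) = ∫_0^{s ∧ u} ∂_s K_{H₁,H₂}(s,v) ∂_u K_{H₁,H₂}(u,v) dv`,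
meaningful for `s, u > 0`, `s ≠ u` (it is singular on the diagonal, which has measure zero). -/
def kernelk (H₁ H₂ s u : ℝ) : ℝ :=
  ∫ v in Ioo 0 (min s u), dKernelK H₁ H₂ s v * dKernelK H₁ H₂ u v

/-- The integral equation
`γ_{H₁}² u^{1-2H₁} = γ_{H₁}² h(u) u^{1-2H₁} + ∫_0^T h(s) k(s,u) ds`
holds at the point `u`, its integral being absolutely convergent. -/
def SolvesAt (H₁ H₂ T : ℝ) (h : ℝ → ℝ) (u : ℝ) : Prop :=
  IntegrableOn (fun s => h s * kernelk H₁ H₂ s u) (Ioc 0 T) ∧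
  gammaH H₁ ^ 2 * u ^ (1 - 2 * H₁) =
    gammaH H₁ ^ 2 * h u * u ^ (1 - 2 * H₁) + ∫ s in Ioc 0 T, h s * kernelk H₁ H₂ s u

/-- `h` is a solution on `[0,T]` in the almost everywhere sense: it is measurable there (up to a
null set) and the equation holds at almost every `u ∈ [0,T]`. No integrability of `h` is required
beyond convergence of the integrals in the equation. -/
def IsSolution (H₁ H₂ T : ℝ) (h : ℝ → ℝ) : Prop :=
  AEStronglyMeasurable h (volume.restrict (Ioc 0 T)) ∧
  ∀ᵐ u ∂(volume.restrict (Ioc 0 T)), SolvesAt H₁ H₂ T h u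

end

end MixedFBM

namespace MixedFBM

/-! ### Second-kind equations with a positive semidefinite L² kernel -/

section IntegralEquation

variable {X : Type*} [MeasurableSpace X] {μ : Measure X} {κ : X → X → ℝ}

/-! Write d = H₂ - H₁, w(s) = s^{1/2-H₁}, γ = γ_{H₁}. Multiplying the equation by u^{H₁-1/2} and
taking φ = h·w as the unknown turns it into γ²φ + Kφ = γ²w, where K has the symmetric kernel κ(s,u)
= (su)^{H₁-1/2} k(s,u) (`solvesAt_iff`). By definition of k, κ is a Gram kernel ∫ m(s,v) m(u,v) dv
with m ≥ 0, so K is positive semidefinite (`integral_kernel_nonneg_of_factorization`). Once κ is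
square integrable, γ² + K is coercive on L², and Lax–Milgram solves the equation
(`exists_memLp_integral_eq`). No condition on the spectrum or on the size of T enters, so every T >
0 is admissible and the sequence is arbitrary.

The analytic content is the size of κ. The derivative ∂_t K(t,s) is comparable to
s^{1/2-H₂}(t-s)^{d-1}t^d (`exists_dKernelFormula_bounds`). Hence κ(s,u) ≤ w(s) q(s,u), where q(s,u)
= C(u^{-p} + |s-u|^{-p}) and p may be any exponent in (1-2d, 1-d] (`exists_weightedKernel_le`). The
gap d > 1/4 is what allows p < 1/2, and then the rows of q are bounded in L² uniformly in s.

A competing solution g is not assumed to be in any L² space. The lower bound κ(s,u) ≥ c w(s)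
u^{H₁-1/2} (`exists_le_weightedKernel`) shows that convergence of the integral at a single u already
makes g·w² integrable. The upper bound then puts K(g·w) in L² (`memLp_integral_of_weighted`), the
equation puts g·w itself in L², and positivity forces the difference of two solutions to vanish. -/

lemma memLp_two_mul_prod [SFinite μ] {φ ψ : X → ℝ} (hφ : MemLp φ 2 μ) (hψ : MemLp ψ 2 μ) :
    MemLp (fun z : X × X => φ z.1 * ψ z.2) 2 (μ.prod μ) := by
  have hm : AEStronglyMeasurable (fun z : X × X => φ z.1 * ψ z.2) (μ.prod μ) :=
    hφ.1.comp_fst.mul hψ.1.comp_snd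
  rw [memLp_two_iff_integrable_sq hm]
  refine ((hφ.integrable_sq).mul_prod (hψ.integrable_sq)).congr (ae_of_all _ fun z => ?_)
  simp only [mul_pow]

lemma norm_toLp_eq_sqrt (φ : Lp ℝ 2 μ) : ‖φ‖ = √(∫ x, φ x ^ 2 ∂μ) := by
  have h : inner ℝ φ φ = ∫ x, φ x ^ 2 ∂μ := by
    rw [L2.inner_def]
    refine integral_congr_ae (ae_of_all _ fun x => ?_)
    simp [sq]
  rw [← h, real_inner_self_eq_norm_sq, Real.sqrt_sq (norm_nonneg _)]

variable [IsFiniteMeasure μ]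

lemma integrable_kernel_mul (hκ : MemLp (fun z : X × X => κ z.1 z.2) 2 (μ.prod μ))
    {φ ψ : X → ℝ} (hφ : MemLp φ 2 μ) (hψ : MemLp ψ 2 μ) :
    Integrable (fun z : X × X => κ z.1 z.2 * (φ z.1 * ψ z.2)) (μ.prod μ) :=
  hκ.integrable_mul (memLp_two_mul_prod hφ hψ)

/-- Cauchy–Schwarz on the product space, where the norm of φ ⊗ ψ factors. This is the
Hilbert–Schmidt bound that makes `kernelForm` continuous. -/
lemma abs_integral_kernel_mul_le (hκ : MemLp (fun z : X × X => κ z.1 z.2) 2 (μ.prod μ))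
    {φ ψ : X → ℝ} (hφ : MemLp φ 2 μ) (hψ : MemLp ψ 2 μ) :
    |∫ z, κ z.1 z.2 * (φ z.1 * ψ z.2) ∂(μ.prod μ)| ≤
      √(∫ z, κ z.1 z.2 ^ 2 ∂(μ.prod μ)) * √(∫ x, φ x ^ 2 ∂μ) * √(∫ x, ψ x ^ 2 ∂μ) := by
  have h2 : ENNReal.ofReal 2 = 2 := by norm_num
  have key := integral_mul_norm_le_Lp_mul_Lq (μ := μ.prod μ) Real.HolderConjugate.two_two
    (f := fun z : X × X => κ z.1 z.2) (g := fun z : X × X => φ z.1 * ψ z.2)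
    (by rw [h2]; exact hκ) (by rw [h2]; exact memLp_two_mul_prod hφ hψ)
  have e1 : ∫ z, ‖φ z.1 * ψ z.2‖ ^ (2 : ℝ) ∂(μ.prod μ) =
      (∫ x, φ x ^ 2 ∂μ) * ∫ x, ψ x ^ 2 ∂μ := by
    rw [← integral_prod_mul]
    refine integral_congr_ae (ae_of_all _ fun z => ?_)
    simp [mul_pow]
  have e2 : ∫ z, ‖κ z.1 z.2‖ ^ (2 : ℝ) ∂(μ.prod μ) = ∫ z, κ z.1 z.2 ^ 2 ∂(μ.prod μ) := by
    refine integral_congr_ae (ae_of_all _ fun z => ?_)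
    simp
  rw [e1, e2, ← Real.sqrt_eq_rpow, ← Real.sqrt_eq_rpow,
    Real.sqrt_mul (integral_nonneg fun x => sq_nonneg _), ← mul_assoc] at key
  refine le_trans ?_ key
  refine (abs_integral_le_integral_abs).trans (le_of_eq ?_)
  refine integral_congr_ae (ae_of_all _ fun z => ?_)
  simp [abs_mul]

/-- The bilinear form of a square integrable kernel on `L²`. -/
noncomputable def kernelForm (hκ : MemLp (fun z : X × X => κ z.1 z.2) 2 (μ.prod μ)) :
    Lp ℝ 2 μ →L[ℝ] Lp ℝ 2 μ →L[ℝ] ℝ :=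
  LinearMap.mkContinuous₂
    (LinearMap.mk₂ ℝ
      (fun φ ψ : Lp ℝ 2 μ => ∫ z, κ z.1 z.2 * (φ z.1 * ψ z.2) ∂(μ.prod μ))
      (fun φ φ' ψ => by
        rw [← integral_add (integrable_kernel_mul hκ (Lp.memLp φ) (Lp.memLp ψ))
          (integrable_kernel_mul hκ (Lp.memLp φ') (Lp.memLp ψ))]
        refine integral_congr_ae ?_
        filter_upwards [Measure.quasiMeasurePreserving_fst.ae (Lp.coeFn_add φ φ')] with z hz
        rw [hz, Pi.add_apply]; ring)
      (fun c φ ψ => by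
        rw [smul_eq_mul, ← integral_const_mul]
        refine integral_congr_ae ?_
        filter_upwards [Measure.quasiMeasurePreserving_fst.ae (Lp.coeFn_smul c φ)] with z hz
        rw [hz, Pi.smul_apply, smul_eq_mul]; ring)
      (fun φ ψ ψ' => by
        rw [← integral_add (integrable_kernel_mul hκ (Lp.memLp φ) (Lp.memLp ψ))
          (integrable_kernel_mul hκ (Lp.memLp φ) (Lp.memLp ψ'))]
        refine integral_congr_ae ?_
        filter_upwards [Measure.quasiMeasurePreserving_snd.ae (Lp.coeFn_add ψ ψ')] with z hz
        rw [hz, Pi.add_apply]; ring)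
      (fun c φ ψ => by
        rw [smul_eq_mul, ← integral_const_mul]
        refine integral_congr_ae ?_
        filter_upwards [Measure.quasiMeasurePreserving_snd.ae (Lp.coeFn_smul c ψ)] with z hz
        rw [hz, Pi.smul_apply, smul_eq_mul]; ring))
    (√(∫ z, κ z.1 z.2 ^ 2 ∂(μ.prod μ)))
    (fun φ ψ => by
      rw [norm_toLp_eq_sqrt φ, norm_toLp_eq_sqrt ψ]
      exact abs_integral_kernel_mul_le hκ (Lp.memLp φ) (Lp.memLp ψ))

lemma kernelForm_apply (hκ : MemLp (fun z : X × X => κ z.1 z.2) 2 (μ.prod μ))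
    (φ ψ : Lp ℝ 2 μ) :
    kernelForm hκ φ ψ = ∫ z, κ z.1 z.2 * (φ z.1 * ψ z.2) ∂(μ.prod μ) := rfl

lemma integrable_integral_kernel_mul
    (hκ : MemLp (fun z : X × X => κ z.1 z.2) 2 (μ.prod μ)) {φ ψ : X → ℝ} (hφ : MemLp φ 2 μ)
    (hψ : MemLp ψ 2 μ) : Integrable (fun u => (∫ s, φ s * κ s u ∂μ) * ψ u) μ := by
  refine (integrable_kernel_mul hκ hφ hψ).integral_prod_right.congr (ae_of_all _ fun u => ?_)
  simp only
  rw [← integral_mul_const]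
  exact integral_congr_ae (ae_of_all _ fun s => by simp only; ring)

lemma integral_kernel_mul_eq
    (hκ : MemLp (fun z : X × X => κ z.1 z.2) 2 (μ.prod μ)) {φ ψ : X → ℝ} (hφ : MemLp φ 2 μ)
    (hψ : MemLp ψ 2 μ) :
    ∫ z, κ z.1 z.2 * (φ z.1 * ψ z.2) ∂(μ.prod μ) = ∫ u, (∫ s, φ s * κ s u ∂μ) * ψ u ∂μ := by
  rw [integral_prod_symm _ (integrable_kernel_mul hκ hφ hψ)]
  refine integral_congr_ae (ae_of_all _ fun u => ?_)
  simp only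
  rw [← integral_mul_const]
  exact integral_congr_ae (ae_of_all _ fun s => by simp only; ring)

/-- An integral equation of the second kind with a positive semidefinite square integrable kernel
has an `L²` solution. -/
theorem exists_memLp_integral_eq (hκ : MemLp (fun z : X × X => κ z.1 z.2) 2 (μ.prod μ))
    (hpos : ∀ φ : X → ℝ, MemLp φ 2 μ → 0 ≤ ∫ z, κ z.1 z.2 * (φ z.1 * φ z.2) ∂(μ.prod μ))
    {c : ℝ} (hc : 0 < c) {f : X → ℝ} (hf : MemLp f 2 μ) :
    ∃ φ : X → ℝ, MemLp φ 2 μ ∧ ∀ᵐ u ∂μ, c * φ u + ∫ s, φ s * κ s u ∂μ = f u := by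
  -- Lax–Milgram: positivity of the kernel leaves c as the coercivity constant of this form.
  set B : Lp ℝ 2 μ →L[ℝ] Lp ℝ 2 μ →L[ℝ] ℝ := 
    c • isBoundedBilinearMap_inner.toContinuousLinearMap + kernelForm hκ with hB
  have hBapp : ∀ φ ψ : Lp ℝ 2 μ, B φ ψ =
      c * inner ℝ φ ψ + ∫ z, κ z.1 z.2 * (φ z.1 * ψ z.2) ∂(μ.prod μ) := by
    intro φ ψ
    simp [hB, kernelForm_apply]
  have hcoer : IsCoercive B := by
    refine ⟨c, hc, fun φ => ?_⟩
    rw [hBapp, real_inner_self_eq_norm_sq]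
    nlinarith [hpos φ (Lp.memLp φ)]
  set φ : Lp ℝ 2 μ := hcoer.continuousLinearEquivOfBilin.symm (hf.toLp f) with hφ
  have hsol : ∀ ψ : Lp ℝ 2 μ, inner ℝ (hf.toLp f) ψ = B φ ψ := by
    intro ψ
    rw [← hcoer.continuousLinearEquivOfBilin_apply φ ψ, hφ]
    simp
  have hφ2 := Lp.memLp φ
  have hone : MemLp (fun _ : X => (1 : ℝ)) 2 μ := memLp_const 1
  have hint : Integrable (fun u => ∫ s, φ s * κ s u ∂μ) μ := by
    simpa using integrable_integral_kernel_mul hκ hφ2 hone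
  have hφi : Integrable φ μ := hφ2.integrable (by norm_num)
  have hfi : Integrable f μ := hf.integrable (by norm_num)
  refine ⟨φ, hφ2, ?_⟩
  have hz : (fun u => c * φ u + ∫ s, φ s * κ s u ∂μ - f u) =ᵐ[μ] 0 := by
    refine Integrable.ae_eq_zero_of_forall_setIntegral_eq_zero
      (((hφi.const_mul c).add hint).sub hfi) fun S hS _ => ?_
    -- Indicators as test functions turn the weak identity into equality of integrals over every
    -- measurable set.
    have hψ : MemLp (S.indicator fun _ : X => (1 : ℝ)) 2 μ := hone.indicator hS
    have hmulind : ∀ G : X → ℝ,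
        ∫ u, G u * S.indicator (fun _ => (1 : ℝ)) u ∂μ = ∫ u in S, G u ∂μ := by
      intro G
      rw [← integral_indicator hS]
      refine integral_congr_ae (ae_of_all _ fun u => ?_)
      by_cases hu : u ∈ S <;> simp [hu]
    have hmain := hsol (hψ.toLp _)
    rw [hBapp, integral_kernel_mul_eq hκ hφ2 (Lp.memLp _), L2.inner_def, L2.inner_def] at hmain
    have e1 : ∫ u, inner ℝ (hf.toLp f u) (hψ.toLp _ u) ∂μ = ∫ u in S, f u ∂μ := by
      rw [← hmulind]
      refine integral_congr_ae ?_
      filter_upwards [hf.coeFn_toLp, hψ.coeFn_toLp] with u h1 h2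
      rw [h1, h2]; simp [mul_comm]
    have e2 : ∫ u, inner ℝ (φ u) (hψ.toLp _ u) ∂μ = ∫ u in S, φ u ∂μ := by
      rw [← hmulind]
      refine integral_congr_ae ?_
      filter_upwards [hψ.coeFn_toLp] with u h2
      rw [h2]; simp [mul_comm]
    have e3 : ∫ u, (∫ s, φ s * κ s u ∂μ) * (hψ.toLp _ u) ∂μ =
        ∫ u in S, ∫ s, φ s * κ s u ∂μ ∂μ := by
      rw [← hmulind]
      refine integral_congr_ae ?_
      filter_upwards [hψ.coeFn_toLp] with u h2
      rw [h2]
    rw [e1, e2, e3] at hmain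
    have h1 : IntegrableOn (fun u => c * φ u) S μ := (hφi.const_mul c).integrableOn
    have h2 : IntegrableOn (fun u => c * φ u + ∫ s, φ s * κ s u ∂μ) S μ :=
      h1.add hint.integrableOn
    rw [integral_sub h2 hfi.integrableOn, integral_add h1 hint.integrableOn, integral_const_mul, hmain, sub_self]
  filter_upwards [hz] with u hu
  simp only [Pi.zero_apply] at hu
  linarith

/-- The homogeneous equation of the second kind with a positive semidefinite square integrable
kernel has only the trivial `L²` solution. -/
theorem ae_eq_zero_of_integral_eq_zero
    (hκ : MemLp (fun z : X × X => κ z.1 z.2) 2 (μ.prod μ))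
    (hpos : ∀ φ : X → ℝ, MemLp φ 2 μ → 0 ≤ ∫ z, κ z.1 z.2 * (φ z.1 * φ z.2) ∂(μ.prod μ))
    {c : ℝ} (hc : 0 < c) {φ : X → ℝ} (hφ : MemLp φ 2 μ)
    (h : ∀ᵐ u ∂μ, c * φ u + ∫ s, φ s * κ s u ∂μ = 0) : φ =ᵐ[μ] 0 := by
  have h0 : ∫ u, (c * φ u ^ 2 + (∫ s, φ s * κ s u ∂μ) * φ u) ∂μ = 0 := by
    refine integral_eq_zero_of_ae ?_
    filter_upwards [h] with u hu
    simp only [Pi.zero_apply]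
    linear_combination φ u * hu
  rw [integral_add (hφ.integrable_sq.const_mul c) (integrable_integral_kernel_mul hκ hφ hφ),
    integral_const_mul, ← integral_kernel_mul_eq hκ hφ hφ] at h0
  have h1 : 0 ≤ ∫ u, φ u ^ 2 ∂μ := integral_nonneg fun u => sq_nonneg _
  have h2 : ∫ u, φ u ^ 2 ∂μ = 0 := by nlinarith [hpos φ hφ]
  rw [integral_eq_zero_iff_of_nonneg (fun u => sq_nonneg _) hφ.integrable_sq] at h2
  filter_upwards [h2] with u hu
  simpa using hu

/-- A kernel of the form `∫ m(s,v) m(u,v) dv` with `m ≥ 0` is positive semidefinite. -/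
theorem integral_kernel_nonneg_of_factorization {Y : Type*} [MeasurableSpace Y] {ν : Measure Y}
    [SFinite ν] (hκ : MemLp (fun z : X × X => κ z.1 z.2) 2 (μ.prod μ)) {m : X → Y → ℝ}
    (hm : Measurable (fun z : X × Y => m z.1 z.2))
    (hm0 : ∀ᵐ s ∂μ, ∀ v, 0 ≤ m s v)
    (hmi : ∀ᵐ z ∂(μ.prod μ), Integrable (fun v => m z.1 v * m z.2 v) ν)
    (hmκ : ∀ᵐ z ∂(μ.prod μ), κ z.1 z.2 = ∫ v, m z.1 v * m z.2 v ∂ν)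
    {φ : X → ℝ} (hφ : MemLp φ 2 μ) :
    0 ≤ ∫ z, κ z.1 z.2 * (φ z.1 * φ z.2) ∂(μ.prod μ) := by
  have hF : Integrable (fun w : (X × X) × Y =>
      (m w.1.1 w.2 * φ w.1.1) * (m w.1.2 w.2 * φ w.1.2)) ((μ.prod μ).prod ν) := by
    have hmeas : AEStronglyMeasurable (fun w : (X × X) × Y =>
        (m w.1.1 w.2 * φ w.1.1) * (m w.1.2 w.2 * φ w.1.2)) ((μ.prod μ).prod ν) := by
      have m1 : AEStronglyMeasurable (fun w : (X × X) × Y => m w.1.1 w.2 * φ w.1.1)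
          ((μ.prod μ).prod ν) :=
        (hm.comp (measurable_fst.fst.prodMk measurable_snd)).aestronglyMeasurable.mul
          hφ.1.comp_fst.comp_fst
      have m2 : AEStronglyMeasurable (fun w : (X × X) × Y => m w.1.2 w.2 * φ w.1.2)
          ((μ.prod μ).prod ν) :=
        (hm.comp (measurable_fst.snd.prodMk measurable_snd)).aestronglyMeasurable.mul
          hφ.1.comp_snd.comp_fst
      exact m1.mul m2
    rw [integrable_prod_iff hmeas]
    constructor
    · filter_upwards [hmi] with z hz
      exact (hz.mul_const (φ z.1 * φ z.2)).congr (ae_of_all _ fun v => by simp only; ring)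
    -- Since m ≥ 0, integrating the absolute value over v gives exactly κ |φ(s)| |φ(u)|, so no
    -- cancellation is lost in Fubini.
    · refine (integrable_kernel_mul hκ hφ hφ).norm.congr ?_
      filter_upwards [hmκ, Measure.quasiMeasurePreserving_fst.ae hm0,
        Measure.quasiMeasurePreserving_snd.ae hm0] with z hz h1 h2
      have hnn : 0 ≤ κ z.1 z.2 := by
        rw [hz]; exact integral_nonneg fun v => mul_nonneg (h1 v) (h2 v)
      rw [norm_mul, Real.norm_of_nonneg hnn, hz, ← integral_mul_const]
      refine integral_congr_ae (ae_of_all _ fun v => ?_)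
      simp only [norm_mul, Real.norm_of_nonneg (h1 v), Real.norm_of_nonneg (h2 v)]
      ring
  -- Integrating over v last exhibits the quadratic form as the integral of a square.
  have e : ∫ z, κ z.1 z.2 * (φ z.1 * φ z.2) ∂(μ.prod μ) =
      ∫ v, (∫ s, m s v * φ s ∂μ) * (∫ s, m s v * φ s ∂μ) ∂ν := by
    have e1 := integral_prod _ hF
    rw [integral_prod_symm _ hF] at e1
    simp only at e1
    have e2 : ∀ v, ∫ z : X × X, m z.1 v * φ z.1 * (m z.2 v * φ z.2) ∂(μ.prod μ) =
        (∫ s, m s v * φ s ∂μ) * (∫ s, m s v * φ s ∂μ) := fun v =>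
      integral_prod_mul (fun s => m s v * φ s) (fun s => m s v * φ s)
    simp_rw [e2] at e1
    rw [e1]
    refine integral_congr_ae ?_
    filter_upwards [hmκ] with z hz
    rw [hz, ← integral_mul_const]
    exact integral_congr_ae (ae_of_all _ fun v => by simp only; ring)
  rw [e]
  exact integral_nonneg fun v => mul_self_nonneg _

/-- An integral operator maps `w⁻¹`-weighted `L¹` functions to `L²` when its kernel is dominated by
`w(s) q(s,u)` with `q(s,·)` bounded in `L²` uniformly in `s`. -/
theorem memLp_integral_of_weighted (hκ : Measurable (fun z : X × X => κ z.1 z.2))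
    {q : X → X → ℝ} (hq : Measurable (fun z : X × X => q z.1 z.2)) {w : X → ℝ}
    (hdom : ∀ᵐ u ∂μ, ∀ᵐ s ∂μ, |κ s u| ≤ w s * q s u)
    {M : ENNReal} (hM : M ≠ ⊤) (hqM : ∀ᵐ s ∂μ, ∫⁻ u, ENNReal.ofReal (q s u) ^ 2 ∂μ ≤ M)
    {φ : X → ℝ} (hφm : AEStronglyMeasurable φ μ) (hw0 : ∀ᵐ s ∂μ, 0 ≤ w s)
    (hφ : Integrable (fun s => φ s * w s) μ) :
    MemLp (fun u => ∫ s, φ s * κ s u ∂μ) 2 μ := by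
  have hmeas : AEStronglyMeasurable (fun u => ∫ s, φ s * κ s u ∂μ) μ := by
    have : AEStronglyMeasurable (fun z : X × X => φ z.2 * κ z.2 z.1) (μ.prod μ) :=
      hφm.comp_snd.mul (hκ.comp measurable_swap).aestronglyMeasurable
    exact this.integral_prod_right'
  refine ⟨hmeas, ?_⟩
  rw [eLpNorm_lt_top_iff_lintegral_rpow_enorm_lt_top (by norm_num) (by norm_num)]
  simp only [ENNReal.toReal_ofNat, ENNReal.rpow_ofNat]
  set r : X → ENNReal := fun s => ‖φ s * w s‖ₑ with hr
  have hrm : AEMeasurable r μ := hφ.1.enorm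
  set Q : X → X → ENNReal := fun s u => ENNReal.ofReal (q s u) with hQ
  have hQm : Measurable (fun z : X × X => Q z.1 z.2) := hq.ennreal_ofReal
  have hrtop : ∫⁻ s, r s ∂μ < ⊤ := hφ.2
  -- Cauchy–Schwarz with respect to the finite measure r dμ; Tonelli then brings the u-integral of
  -- q² inside, where it is at most M.
  have hCS : ∀ᵐ u ∂μ, ‖∫ s, φ s * κ s u ∂μ‖ₑ ^ 2 ≤
      (∫⁻ s, r s ∂μ) * ∫⁻ s, r s * Q s u ^ 2 ∂μ := by
    filter_upwards [hdom] with u hu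
    have h1 : ‖∫ s, φ s * κ s u ∂μ‖ₑ ≤
        ∫⁻ s, ((fun s => r s ^ (1 / 2 : ℝ)) * fun s => r s ^ (1 / 2 : ℝ) * Q s u) s ∂μ := by
      refine (enorm_integral_le_lintegral_enorm _).trans (lintegral_mono_ae ?_)
      filter_upwards [hu, hw0] with s hs hws
      have : r s ^ (1 / 2 : ℝ) * (r s ^ (1 / 2 : ℝ) * Q s u) = r s * Q s u := by
        rw [← mul_assoc, ← ENNReal.rpow_add_of_nonneg _ _ (by norm_num) (by norm_num)]
        norm_num
      simp only [Pi.mul_apply, this]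
      rw [hr]
      simp only
      rw [enorm_mul, enorm_mul, mul_assoc]
      gcongr
      rw [Real.enorm_eq_ofReal_abs, Real.enorm_eq_ofReal_abs, abs_of_nonneg hws,
        ← ENNReal.ofReal_mul hws]
      exact ENNReal.ofReal_le_ofReal hs
    have h2 := ENNReal.lintegral_mul_le_Lp_mul_Lq μ Real.HolderConjugate.two_two
      (f := fun s => r s ^ (1 / 2 : ℝ)) (g := fun s => r s ^ (1 / 2 : ℝ) * Q s u)
      (hrm.pow_const _) ((hrm.pow_const _).mul
        (hQm.comp (measurable_id.prodMk measurable_const)).aemeasurable)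
    have h3 : ∀ s, (r s ^ (1 / 2 : ℝ)) ^ (2 : ℝ) = r s := by
      intro s; rw [← ENNReal.rpow_mul]; norm_num
    have h4 : ∀ s, (r s ^ (1 / 2 : ℝ) * Q s u) ^ (2 : ℝ) = r s * Q s u ^ 2 := by
      intro s; rw [ENNReal.mul_rpow_of_nonneg _ _ (by norm_num), h3]; norm_num
    simp_rw [h3, h4] at h2
    calc ‖∫ s, φ s * κ s u ∂μ‖ₑ ^ 2
        ≤ ((∫⁻ s, r s ∂μ) ^ (1 / 2 : ℝ) * (∫⁻ s, r s * Q s u ^ 2 ∂μ) ^ (1 / 2 : ℝ)) ^ 2 := by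
          gcongr; exact h1.trans h2
      _ = _ := by
          rw [mul_pow, ← ENNReal.rpow_natCast, ← ENNReal.rpow_natCast, ← ENNReal.rpow_mul,
            ← ENNReal.rpow_mul]
          norm_num
  refine lt_of_le_of_lt (lintegral_mono_ae hCS) ?_
  have hjoint : AEMeasurable (fun z : X × X => r z.2 * Q z.2 z.1 ^ 2) (μ.prod μ) :=
    hrm.comp_snd.mul ((hQm.comp measurable_swap).pow_const 2).aemeasurable
  rw [lintegral_const_mul' _ _ hrtop.ne]
  refine ENNReal.mul_lt_top hrtop ?_
  rw [lintegral_lintegral_swap hjoint]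
  have : ∫⁻ s, ∫⁻ u, r s * Q s u ^ 2 ∂μ ∂μ ≤ ∫⁻ s, r s * M ∂μ := by
    refine lintegral_mono_ae ?_
    filter_upwards [hqM] with s hs
    have hQs : Measurable (fun u => Q s u ^ 2) :=
      (hQm.comp (measurable_const.prodMk measurable_id)).pow_const 2
    rw [lintegral_const_mul _ hQs]
    gcongr
  refine this.trans_lt ?_
  rw [lintegral_mul_const' _ _ hM]
  exact ENNReal.mul_lt_top hrtop hM.lt_top

/-- A kernel dominated by `w(s) q(s,u)`, with `w` in `L²` and `q(s,·)` bounded in `L²` uniformly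
in `s`, is square integrable. -/
theorem memLp_two_of_weighted (hκ : Measurable (fun z : X × X => κ z.1 z.2))
    {q : X → X → ℝ} {w : X → ℝ} (hw : MemLp w 2 μ) (hw0 : ∀ᵐ s ∂μ, 0 ≤ w s)
    (hdom : ∀ᵐ s ∂μ, ∀ᵐ u ∂μ, |κ s u| ≤ w s * q s u)
    {M : ENNReal} (hM : M ≠ ⊤) (hqM : ∀ᵐ s ∂μ, ∫⁻ u, ENNReal.ofReal (q s u) ^ 2 ∂μ ≤ M) :
    MemLp (fun z : X × X => κ z.1 z.2) 2 (μ.prod μ) := by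
  refine ⟨hκ.aestronglyMeasurable, ?_⟩
  have hw2 := hw.2
  rw [eLpNorm_lt_top_iff_lintegral_rpow_enorm_lt_top (by norm_num) (by norm_num)] at hw2 ⊢
  simp only [ENNReal.toReal_ofNat, ENNReal.rpow_ofNat] at hw2 ⊢
  rw [lintegral_prod _ (hκ.enorm.pow_const 2).aemeasurable]
  have hle : ∫⁻ s, ∫⁻ u, ‖κ s u‖ₑ ^ 2 ∂μ ∂μ ≤ ∫⁻ s, ‖w s‖ₑ ^ 2 * M ∂μ := by
    refine lintegral_mono_ae ?_
    filter_upwards [hdom, hqM, hw0] with s hs hqs hws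
    calc ∫⁻ u, ‖κ s u‖ₑ ^ 2 ∂μ
        ≤ ∫⁻ u, ‖w s‖ₑ ^ 2 * ENNReal.ofReal (q s u) ^ 2 ∂μ := by
          refine lintegral_mono_ae ?_
          filter_upwards [hs] with u hu
          rw [← mul_pow, Real.enorm_eq_ofReal_abs, Real.enorm_eq_ofReal_abs, abs_of_nonneg hws,
            ← ENNReal.ofReal_mul hws]
          gcongr
      _ = ‖w s‖ₑ ^ 2 * ∫⁻ u, ENNReal.ofReal (q s u) ^ 2 ∂μ :=
          lintegral_const_mul' _ _ (by finiteness)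
      _ ≤ _ := by gcongr
  refine hle.trans_lt ?_
  rw [lintegral_mul_const' _ _ hM]
  exact ENNReal.mul_lt_top hw2 hM.lt_top

end IntegralEquation

/-! ### Beta integrals on an interval -/

lemma integrableOn_rpow_mul_one_sub_rpow {p q : ℝ} (hp : -1 < p) (hq : -1 < q) :
    IntegrableOn (fun x : ℝ => x ^ p * (1 - x) ^ q) (Ioo 0 1) := by
  have h := (Complex.betaIntegral_convergent (u := ((p + 1 : ℝ) : ℂ)) (v := ((q + 1 : ℝ) : ℂ))
    (by simp; linarith) (by simp; linarith)).norm
  rw [intervalIntegrable_iff_integrableOn_Ioo_of_le zero_le_one] at h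
  refine h.congr_fun (fun x hx => ?_) measurableSet_Ioo
  have h1 : (1 - (x : ℂ)) = ((1 - x : ℝ) : ℂ) := by push_cast; ring
  simp only [norm_mul]
  rw [h1, Complex.norm_cpow_eq_rpow_re_of_pos hx.1,
    Complex.norm_cpow_eq_rpow_re_of_pos (by linarith [hx.2])]
  simp

lemma integrableOn_rpow_mul_sub_rpow {p q x : ℝ} (hp : -1 < p) (hq : -1 < q) (hx : 0 < x) :
    IntegrableOn (fun v : ℝ => v ^ p * (x - v) ^ q) (Ioo 0 x) := by
  have h := integrableOn_rpow_mul_one_sub_rpow hp hq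
  rw [← intervalIntegrable_iff_integrableOn_Ioo_of_le zero_le_one] at h
  have h2 := (h.comp_mul_right (c := x⁻¹)).const_mul (x ^ p * x ^ q)
  simp only [zero_div, one_div, inv_inv] at h2
  rw [intervalIntegrable_iff_integrableOn_Ioo_of_le hx.le] at h2
  refine h2.congr_fun (fun v hv => ?_) measurableSet_Ioo
  have e : x - v = x * (1 - v * x⁻¹) := by field_simp
  have h3 : 0 ≤ 1 - v * x⁻¹ := by
    rw [← div_eq_mul_inv, sub_nonneg, div_le_one hx]; exact hv.2.le
  simp only
  rw [e, Real.mul_rpow hx.le h3, Real.mul_rpow hv.1.le (inv_nonneg.2 hx.le),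
    Real.inv_rpow hx.le]
  have := (Real.rpow_pos_of_pos hx p).ne'
  field_simp

lemma integral_rpow_mul_sub_rpow {x : ℝ} (p q : ℝ) (hx : 0 < x) :
    ∫ v in Ioo 0 x, v ^ p * (x - v) ^ q =
      x ^ (p + q + 1) * ∫ v in Ioo (0 : ℝ) 1, v ^ p * (1 - v) ^ q := by
  rw [← integral_Ioc_eq_integral_Ioo, ← integral_Ioc_eq_integral_Ioo,
    ← intervalIntegral.integral_of_le hx.le, ← intervalIntegral.integral_of_le zero_le_one]
  have h := intervalIntegral.mul_integral_comp_mul_left (a := 0) (b := 1)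
    (f := fun v : ℝ => v ^ p * (x - v) ^ q) (c := x)
  rw [mul_zero, mul_one] at h
  rw [← h, ← intervalIntegral.integral_const_mul, ← intervalIntegral.integral_const_mul]
  refine intervalIntegral.integral_congr fun v hv => ?_
  rw [uIcc_of_le zero_le_one] at hv
  have e : x - x * v = x * (1 - v) := by ring
  rw [e, Real.mul_rpow hx.le hv.1, Real.mul_rpow hx.le (by linarith [hv.2]),
    Real.rpow_add hx, Real.rpow_add hx, Real.rpow_one]
  ring

/-! ### The derivative of the kernel K and its size -/

/-- The beta weight `x^{H₂-3/2} (1-x)^{1/2-H₁}`. -/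
noncomputable def betaWeight (H₁ H₂ x : ℝ) : ℝ := x ^ (H₂ - 3 / 2) * (1 - x) ^ (1 / 2 - H₁)

/-- The integral left of `kernelK` after scaling `[s,t]` to `[0,1]`. -/
noncomputable def scaledKernel (H₁ H₂ t s : ℝ) : ℝ :=
  ∫ x in Ioo (0 : ℝ) 1, betaWeight H₁ H₂ x * (s + (t - s) * x) ^ (H₂ - H₁)

/-- The derivative of `scaledKernel` in its first variable. -/
noncomputable def scaledKernelDeriv (H₁ H₂ t s : ℝ) : ℝ :=
  ∫ x in Ioo (0 : ℝ) 1,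
    betaWeight H₁ H₂ x * (x * ((H₂ - H₁) * (s + (t - s) * x) ^ (H₂ - H₁ - 1)))

/-- The closed form of `dKernelK` for `0 < s < t`. -/
noncomputable def dKernelFormula (H₁ H₂ t s : ℝ) : ℝ :=
  betaH H₂ * s ^ (1 / 2 - H₂) *
    ((H₂ - H₁) * (t - s) ^ (H₂ - H₁ - 1) * scaledKernel H₁ H₂ t s +
      (t - s) ^ (H₂ - H₁) * scaledKernelDeriv H₁ H₂ t s)

section

variable {H₁ H₂ : ℝ}

lemma measurable_betaWeight : Measurable (betaWeight H₁ H₂) := by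
  unfold betaWeight; fun_prop

lemma measurable_dKernelFormula :
    Measurable (fun z : ℝ × ℝ => dKernelFormula H₁ H₂ z.1 z.2) := by
  have hw := measurable_betaWeight (H₁ := H₁) (H₂ := H₂)
  have h0 : Measurable (fun z : ℝ × ℝ => scaledKernel H₁ H₂ z.1 z.2) := by
    have : Measurable (fun w : (ℝ × ℝ) × ℝ =>
        betaWeight H₁ H₂ w.2 * (w.1.2 + (w.1.1 - w.1.2) * w.2) ^ (H₂ - H₁)) := by fun_prop
    exact (this.stronglyMeasurable.integral_prod_right' (ν := volume.restrict (Ioo 0 1))).measurable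
  have h1 : Measurable (fun z : ℝ × ℝ => scaledKernelDeriv H₁ H₂ z.1 z.2) := by
    have : Measurable (fun w : (ℝ × ℝ) × ℝ => betaWeight H₁ H₂ w.2 *
        (w.2 * ((H₂ - H₁) * (w.1.2 + (w.1.1 - w.1.2) * w.2) ^ (H₂ - H₁ - 1)))) := by fun_prop
    exact (this.stronglyMeasurable.integral_prod_right' (ν := volume.restrict (Ioo 0 1))).measurable
  unfold dKernelFormula
  fun_prop

lemma betaWeight_pos {x : ℝ} (hx : x ∈ Ioo (0 : ℝ) 1) : 0 < betaWeight H₁ H₂ x :=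
  mul_pos (Real.rpow_pos_of_pos hx.1 _) (Real.rpow_pos_of_pos (by linarith [hx.2]) _)

lemma integrableOn_betaWeight (h₁ : H₁ < 1) (h₂ : 1 / 2 < H₂) :
    IntegrableOn (betaWeight H₁ H₂) (Ioo 0 1) :=
  integrableOn_rpow_mul_one_sub_rpow (by linarith) (by linarith)

/-- The substitution u = s + (t-s)x removes t from the limits and from the singular factors. What
remains under the integral is smooth in t, so differentiation under the integral sign becomes
available. -/
lemma kernelK_eq (h₁ : H₁ < 1) {s t : ℝ} (hst : s < t) :
    kernelK H₁ H₂ t s =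
      betaH H₂ * s ^ (1 / 2 - H₂) * ((t - s) ^ (H₂ - H₁) * scaledKernel H₁ H₂ t s) := by
  have hts : 0 < t - s := sub_pos.2 hst
  unfold kernelK scaledKernel
  congr 1
  have h := intervalIntegral.mul_integral_comp_add_mul (a := 0) (b := 1)
    (f := fun u : ℝ => (t - u) ^ (1 / 2 - H₁) * u ^ (H₂ - H₁) * (u - s) ^ (H₂ - 3 / 2))
    (c := t - s) s
  rw [mul_zero, mul_one, add_zero, add_sub_cancel] at h
  rw [← h, ← integral_Ioc_eq_integral_Ioo, ← intervalIntegral.integral_of_le zero_le_one,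
    ← intervalIntegral.integral_const_mul, ← intervalIntegral.integral_const_mul]
  refine intervalIntegral.integral_congr fun x hx => ?_
  rw [uIcc_of_le zero_le_one] at hx
  have e1 : t - (s + (t - s) * x) = (t - s) * (1 - x) := by ring
  have e2 : s + (t - s) * x - s = (t - s) * x := by ring
  simp only [betaWeight]
  rw [e1, e2, Real.mul_rpow hts.le (by linarith [hx.2]), Real.mul_rpow hts.le hx.1]
  have e3 : (t - s) ^ (H₂ - H₁) = (t - s) * (t - s) ^ (1 / 2 - H₁) * (t - s) ^ (H₂ - 3 / 2) := by
    rw [← Real.rpow_one_add' hts.le, ← Real.rpow_add hts]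
    · congr 1; ring
    · linarith
  rw [e3]; ring

lemma lt_affine {s t x : ℝ} (hst : s < t) (hx : x ∈ Ioo (0 : ℝ) 1) :
    s < s + (t - s) * x := by
  have := mul_pos (sub_pos.2 hst) hx.1
  linarith

lemma integrableOn_scaledKernel (h₁ : H₁ < 1) (h₂ : 1 / 2 < H₂) (h₁₂ : H₁ < H₂) {s t : ℝ}
    (hs : 0 < s) (hst : s < t) :
    IntegrableOn (fun x => betaWeight H₁ H₂ x * (s + (t - s) * x) ^ (H₂ - H₁)) (Ioo 0 1) := by
  refine ((integrableOn_betaWeight h₁ h₂).mul_const (t ^ (H₂ - H₁))).mono' ?_ ?_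
  · exact (measurable_betaWeight.mul (by fun_prop)).aestronglyMeasurable
  · refine (ae_restrict_iff' measurableSet_Ioo).2 (ae_of_all _ fun x hx => ?_)
    have h1 := lt_affine hst hx
    rw [Real.norm_of_nonneg (mul_nonneg (betaWeight_pos hx).le (Real.rpow_nonneg (by linarith) _))]
    refine mul_le_mul_of_nonneg_left ?_ (betaWeight_pos hx).le
    exact Real.rpow_le_rpow (by linarith) (by nlinarith [hx.2]) (by linarith)

/-- The point s + (t-s)x stays above s and the exponent is negative, so the majorant does not depend
on t, as dominated differentiation requires. -/
lemma norm_scaledKernelDeriv_integrand_le (h₁₂ : H₁ < H₂) (hd : H₂ < H₁ + 1) {s t x : ℝ}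
    (hs : 0 < s) (hst : s < t) (hx : x ∈ Ioo (0 : ℝ) 1) :
    ‖betaWeight H₁ H₂ x * (x * ((H₂ - H₁) * (s + (t - s) * x) ^ (H₂ - H₁ - 1)))‖ ≤
      betaWeight H₁ H₂ x * ((H₂ - H₁) * s ^ (H₂ - H₁ - 1)) := by
  have h1 := lt_affine hst hx
  have h2 : 0 < (s + (t - s) * x) ^ (H₂ - H₁ - 1) := Real.rpow_pos_of_pos (hs.trans h1) _
  have hd0 : 0 < H₂ - H₁ := by linarith
  rw [Real.norm_of_nonneg (mul_nonneg (betaWeight_pos hx).le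
    (mul_nonneg hx.1.le (mul_nonneg hd0.le h2.le)))]
  refine mul_le_mul_of_nonneg_left ?_ (betaWeight_pos hx).le
  have h3 : (s + (t - s) * x) ^ (H₂ - H₁ - 1) ≤ s ^ (H₂ - H₁ - 1) :=
    Real.rpow_le_rpow_of_nonpos hs h1.le (by linarith)
  calc x * ((H₂ - H₁) * (s + (t - s) * x) ^ (H₂ - H₁ - 1))
      ≤ 1 * ((H₂ - H₁) * (s + (t - s) * x) ^ (H₂ - H₁ - 1)) :=
        mul_le_mul_of_nonneg_right hx.2.le (mul_nonneg hd0.le h2.le)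
    _ ≤ _ := by rw [one_mul]; exact mul_le_mul_of_nonneg_left h3 hd0.le

lemma hasDerivAt_scaledKernel (h₁ : H₁ < 1) (h₂ : 1 / 2 < H₂) (h₁₂ : H₁ < H₂)
    (hd : H₂ < H₁ + 1) {s t : ℝ} (hs : 0 < s) (hst : s < t) :
    HasDerivAt (fun t' => scaledKernel H₁ H₂ t' s) (scaledKernelDeriv H₁ H₂ t s) t := by
  have hw := measurable_betaWeight (H₁ := H₁) (H₂ := H₂)
  refine (hasDerivAt_integral_of_dominated_loc_of_deriv_le (Ioi_mem_nhds hst)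
    (F := fun t' x => betaWeight H₁ H₂ x * (s + (t' - s) * x) ^ (H₂ - H₁))
    (F' := fun t' x =>
      betaWeight H₁ H₂ x * (x * ((H₂ - H₁) * (s + (t' - s) * x) ^ (H₂ - H₁ - 1))))
    (bound := fun x => betaWeight H₁ H₂ x * ((H₂ - H₁) * s ^ (H₂ - H₁ - 1)))
    (μ := volume.restrict (Ioo 0 1)) ?_ ?_ ?_ ?_ ?_ ?_).2
  · exact Eventually.of_forall fun t' => Measurable.aestronglyMeasurable (by fun_prop)
  · exact integrableOn_scaledKernel h₁ h₂ h₁₂ hs hst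
  · exact Measurable.aestronglyMeasurable (by fun_prop)
  · exact (ae_restrict_iff' measurableSet_Ioo).2 (ae_of_all _ fun x hx t' ht' =>
      norm_scaledKernelDeriv_integrand_le h₁₂ hd hs ht' hx)
  · exact (integrableOn_betaWeight h₁ h₂).mul_const _
  · refine (ae_restrict_iff' measurableSet_Ioo).2 (ae_of_all _ fun x hx t' ht' => ?_)
    have h1 := lt_affine ht' hx
    have h3 : HasDerivAt (fun t' => s + (t' - s) * x) x t' := by
      simpa using (((hasDerivAt_id t').sub_const s).mul_const x).const_add s
    have h4 := (h3.rpow_const (p := H₂ - H₁) (Or.inl (hs.trans h1).ne')).const_mul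
      (betaWeight H₁ H₂ x)
    refine h4.congr_deriv ?_
    ring

theorem dKernelK_eq (h₁ : H₁ < 1) (h₂ : 1 / 2 < H₂) (h₁₂ : H₁ < H₂)
    (hd : H₂ < H₁ + 1) {s t : ℝ} (hs : 0 < s) (hst : s < t) :
    dKernelK H₁ H₂ t s = dKernelFormula H₁ H₂ t s := by
  have h1 : HasDerivAt (fun t' => (t' - s) ^ (H₂ - H₁))
      ((H₂ - H₁) * (t - s) ^ (H₂ - H₁ - 1)) t := by
    simpa using ((hasDerivAt_id t).sub_const s).rpow_const (p := H₂ - H₁)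
      (Or.inl (sub_pos.2 hst).ne')
  have h2 := (h1.mul (hasDerivAt_scaledKernel h₁ h₂ h₁₂ hd hs hst)).const_mul
    (betaH H₂ * s ^ (1 / 2 - H₂))
  refine (h2.congr_of_eventuallyEq ?_).deriv
  filter_upwards [Ioi_mem_nhds hst] with t' ht'
  exact kernelK_eq h₁ ht'

lemma betaH_pos (h₂ : 1 / 2 < H₂) (h₂' : H₂ < 1) : 0 < betaH H₂ :=
  Real.sqrt_pos.2 (div_pos (mul_pos (by linarith) (by linarith))
    (ProbabilityTheory.beta_pos (by linarith) (by linarith)))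

lemma gammaH_pos {H : ℝ} (h : 1 / 2 < H) (h' : H < 1) : 0 < gammaH H :=
  Real.sqrt_pos.2 (div_pos (mul_pos (mul_pos (mul_pos (by linarith) (by linarith))
    (pow_pos (Real.Gamma_pos_of_pos (by linarith)) 3)) (Real.Gamma_pos_of_pos (by linarith)))
    (Real.Gamma_pos_of_pos (by linarith)))

/-- The derivative of the kernel is comparable to `s^{1/2-H₂} (t-s)^{H₂-H₁-1} t^{H₂-H₁}`. -/
theorem exists_dKernelFormula_bounds (h₁ : H₁ < 1) (h₂ : 1 / 2 < H₂) (h₂' : H₂ < 1)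
    (h₁₂ : H₁ < H₂) (hd : H₂ < H₁ + 1) :
    ∃ c C : ℝ, 0 < c ∧ 0 < C ∧ ∀ s t : ℝ, 0 < s → s < t →
      c * (s ^ (1 / 2 - H₂) * (t - s) ^ (H₂ - H₁ - 1) * t ^ (H₂ - H₁)) ≤
        dKernelFormula H₁ H₂ t s ∧
      dKernelFormula H₁ H₂ t s ≤
        C * (s ^ (1 / 2 - H₂) * (t - s) ^ (H₂ - H₁ - 1) * t ^ (H₂ - H₁)) := by
  have hβ := betaH_pos h₂ h₂'
  have hd0 : 0 < H₂ - H₁ := by linarith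
  have hwi := integrableOn_betaWeight h₁ h₂
  have hvi : IntegrableOn (fun x => betaWeight H₁ H₂ x * x ^ (H₂ - H₁)) (Ioo 0 1) := by
    refine (integrableOn_rpow_mul_one_sub_rpow (p := H₂ - 3 / 2 + (H₂ - H₁)) (q := 1 / 2 - H₁)
      (by linarith) (by linarith)).congr_fun (fun x hx => ?_) measurableSet_Ioo
    simp only [betaWeight]
    rw [Real.rpow_add hx.1]; ring
  have hpos : ∀ f : ℝ → ℝ, (∀ x ∈ Ioo (0 : ℝ) 1, 0 < f x) → IntegrableOn f (Ioo 0 1) →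
      0 < ∫ x in Ioo (0 : ℝ) 1, f x := by
    intro f hf hfi
    rw [setIntegral_pos_iff_support_of_nonneg_ae
      ((ae_restrict_iff' measurableSet_Ioo).2 (ae_of_all _ fun x hx => (hf x hx).le)) hfi]
    have : Function.support f ∩ Ioo 0 1 = Ioo 0 1 :=
      inter_eq_right.2 fun x hx => (hf x hx).ne'
    rw [this]; simp
  have hW := hpos _ (fun x hx => betaWeight_pos (H₁ := H₁) (H₂ := H₂) hx) hwi
  have hV := hpos _ (fun x hx => mul_pos (betaWeight_pos hx)
    (Real.rpow_pos_of_pos hx.1 (H₂ - H₁))) hvi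
  set W := ∫ x in Ioo (0 : ℝ) 1, betaWeight H₁ H₂ x with hWdef
  set V := ∫ x in Ioo (0 : ℝ) 1, betaWeight H₁ H₂ x * x ^ (H₂ - H₁) with hVdef
  -- The first term of `dKernelFormula` alone gives the lower constant. The second is nonnegative
  -- and at most the first, whence the 2.
  refine ⟨betaH H₂ * (H₂ - H₁) * V, betaH H₂ * (2 * (H₂ - H₁)) * W, by positivity, by positivity,
    fun s t hs hst => ?_⟩
  have ht : 0 < t := hs.trans hst
  have hts : 0 < t - s := sub_pos.2 hst
  have hJi := integrableOn_scaledKernel h₁ h₂ h₁₂ hs hst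
  have hJ_le : scaledKernel H₁ H₂ t s ≤ t ^ (H₂ - H₁) * W := by
    rw [mul_comm, hWdef, ← integral_mul_const]
    refine setIntegral_mono_on hJi (hwi.mul_const _) measurableSet_Ioo fun x hx => ?_
    have h1 := lt_affine hst hx
    exact mul_le_mul_of_nonneg_left
      (Real.rpow_le_rpow (by linarith) (by nlinarith [hx.2]) hd0.le) (betaWeight_pos hx).le
  -- Uses s + (t-s)x ≥ t x.
  have hJ_ge : t ^ (H₂ - H₁) * V ≤ scaledKernel H₁ H₂ t s := by
    rw [hVdef, ← integral_const_mul]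
    refine setIntegral_mono_on (hvi.const_mul _) hJi measurableSet_Ioo fun x hx => ?_
    rw [mul_left_comm, ← Real.mul_rpow ht.le hx.1.le]
    exact mul_le_mul_of_nonneg_left
      (Real.rpow_le_rpow (mul_nonneg ht.le hx.1.le) (by nlinarith [hx.2]) hd0.le)
      (betaWeight_pos hx).le
  have hJ1_nonneg : 0 ≤ scaledKernelDeriv H₁ H₂ t s :=
    setIntegral_nonneg measurableSet_Ioo fun x hx => mul_nonneg (betaWeight_pos hx).le
      (mul_nonneg hx.1.le (mul_nonneg hd0.le
        (Real.rpow_nonneg (hs.trans (lt_affine hst hx)).le _)))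
  -- Uses (t-s)x ≤ s + (t-s)x, which raises the exponent d - 1 back to d.
  have hJ1_le : (t - s) * scaledKernelDeriv H₁ H₂ t s ≤ (H₂ - H₁) * scaledKernel H₁ H₂ t s := by
    unfold scaledKernelDeriv scaledKernel
    rw [← integral_const_mul, ← integral_const_mul]
    have hDi : IntegrableOn (fun x => betaWeight H₁ H₂ x *
        (x * ((H₂ - H₁) * (s + (t - s) * x) ^ (H₂ - H₁ - 1)))) (Ioo 0 1) := by
      refine (hwi.mul_const ((H₂ - H₁) * s ^ (H₂ - H₁ - 1))).mono'
        (measurable_betaWeight.mul (by fun_prop)).aestronglyMeasurable ?_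
      exact (ae_restrict_iff' measurableSet_Ioo).2 (ae_of_all _ fun x hx =>
        norm_scaledKernelDeriv_integrand_le h₁₂ hd hs hst hx)
    refine setIntegral_mono_on (hDi.const_mul _) (hJi.const_mul _) measurableSet_Ioo
      fun x hx => ?_
    have h1 := hs.trans (lt_affine hst hx)
    have h2 : (s + (t - s) * x) ^ (H₂ - H₁) =
        (s + (t - s) * x) ^ (H₂ - H₁ - 1) * (s + (t - s) * x) := by
      rw [← Real.rpow_add_one h1.ne']; congr 1; ring
    rw [h2]
    have h3 : 0 ≤ betaWeight H₁ H₂ x * (H₂ - H₁) * (s + (t - s) * x) ^ (H₂ - H₁ - 1) :=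
      mul_nonneg (mul_nonneg (betaWeight_pos hx).le hd0.le) (Real.rpow_nonneg h1.le _)
    nlinarith [mul_nonneg h3 hs.le]
  have hsp : 0 < betaH H₂ * s ^ (1 / 2 - H₂) := mul_pos hβ (Real.rpow_pos_of_pos hs _)
  have htp : 0 < (t - s) ^ (H₂ - H₁ - 1) := Real.rpow_pos_of_pos hts _
  have e : (t - s) ^ (H₂ - H₁) = (t - s) ^ (H₂ - H₁ - 1) * (t - s) := by
    rw [← Real.rpow_add_one hts.ne']; congr 1; ring
  have hform : dKernelFormula H₁ H₂ t s = betaH H₂ * s ^ (1 / 2 - H₂) * (t - s) ^ (H₂ - H₁ - 1) *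
      ((H₂ - H₁) * scaledKernel H₁ H₂ t s + (t - s) * scaledKernelDeriv H₁ H₂ t s) := by
    unfold dKernelFormula; rw [e]; ring
  rw [hform]
  constructor
  · calc _ = betaH H₂ * s ^ (1 / 2 - H₂) * (t - s) ^ (H₂ - H₁ - 1) *
          ((H₂ - H₁) * (t ^ (H₂ - H₁) * V)) := by ring
      _ ≤ _ := by
        refine mul_le_mul_of_nonneg_left ?_ (mul_pos hsp htp).le
        nlinarith [mul_nonneg hts.le hJ1_nonneg, mul_le_mul_of_nonneg_left hJ_ge hd0.le]
  · calc _
      _ ≤ betaH H₂ * s ^ (1 / 2 - H₂) * (t - s) ^ (H₂ - H₁ - 1) *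
          (2 * (H₂ - H₁) * (t ^ (H₂ - H₁) * W)) := by
        refine mul_le_mul_of_nonneg_left ?_ (mul_pos hsp htp).le
        nlinarith [mul_le_mul_of_nonneg_left hJ_le hd0.le]
      _ = _ := by ring

end

/-! ### Two-sided estimates for the kernel k -/

section

variable {H₁ H₂ : ℝ}

lemma measurable_dKernelFormula_left (t : ℝ) :
    Measurable (fun v => dKernelFormula H₁ H₂ t v) :=
  measurable_dKernelFormula.comp (measurable_const.prodMk measurable_id)

/-- Upper bound for the kernel `k`, with a parameter `e` that trades the singularity on the
diagonal against the one at the origin. -/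
theorem exists_integral_dKernelFormula_le (h₁ : H₁ < 1) (h₂ : 1 / 2 < H₂) (h₂' : H₂ < 1)
    (h₁₂ : H₁ < H₂) (hd : H₂ < H₁ + 1) {e : ℝ} (he : 0 < e) (hed : e ≤ H₂ - H₁)
    (he' : 2 * (H₂ - H₁) - 1 ≤ e) :
    ∃ C : ℝ, 0 < C ∧ ∀ x y : ℝ, 0 < x → x < y →
      IntegrableOn (fun v => dKernelFormula H₁ H₂ x v * dKernelFormula H₁ H₂ y v) (Ioo 0 x) ∧
      ∫ v in Ioo 0 x, dKernelFormula H₁ H₂ x v * dKernelFormula H₁ H₂ y v ≤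
        C * (x ^ (1 - 2 * H₁ - (H₂ - H₁) + e) * y ^ (H₂ - H₁) *
          (y - x) ^ (2 * (H₂ - H₁) - 1 - e)) := by
  obtain ⟨c, C, hc, hC, hD⟩ := exists_dKernelFormula_bounds h₁ h₂ h₂' h₁₂ hd
  set b := ∫ v in Ioo (0 : ℝ) 1, v ^ (1 - 2 * H₂) * (1 - v) ^ (e - 1) with hb
  have hb0 : 0 ≤ b := setIntegral_nonneg measurableSet_Ioo fun v hv =>
    mul_nonneg (Real.rpow_nonneg hv.1.le _) (Real.rpow_nonneg (by linarith [hv.2]) _)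
  refine ⟨C ^ 2 * (b + 1), by positivity, fun x y hx hxy => ?_⟩
  have hy : 0 < y := hx.trans hxy
  set A := C ^ 2 * (x ^ (H₂ - H₁) * y ^ (H₂ - H₁) * (y - x) ^ (2 * (H₂ - H₁) - 1 - e)) with hA
  have hA0 : 0 ≤ A := mul_nonneg (sq_nonneg _) (mul_nonneg (mul_nonneg (Real.rpow_nonneg hx.le _)
    (Real.rpow_nonneg hy.le _)) (Real.rpow_nonneg (by linarith) _))
  have hgi := (integrableOn_rpow_mul_sub_rpow (p := 1 - 2 * H₂) (q := e - 1) (by linarith)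
    (by linarith) hx).const_mul A
  have hnn : ∀ t v : ℝ, 0 < v → v < t → 0 ≤ dKernelFormula H₁ H₂ t v := fun t v hv hvt =>
    le_trans (mul_nonneg hc.le (mul_nonneg (mul_nonneg (Real.rpow_nonneg hv.le _)
      (Real.rpow_nonneg (by linarith) _)) (Real.rpow_nonneg (by linarith) _))) (hD v t hv hvt).1
  have hle : ∀ v ∈ Ioo 0 x, dKernelFormula H₁ H₂ x v * dKernelFormula H₁ H₂ y v ≤
      A * (v ^ (1 - 2 * H₂) * (x - v) ^ (e - 1)) := by
    intro v hv
    have hv0 : 0 < v := hv.1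
    have hxv : 0 < x - v := sub_pos.2 hv.2
    have hyv : 0 < y - v := by linarith
    have hyx : 0 < y - x := sub_pos.2 hxy
    -- Both exponents in this splitting are nonpositive by the constraints on e. Since y - v exceeds
    -- both y - x and x - v, one part becomes a power of the distance to the diagonal and the other
    -- joins (x-v)^{d-1} to form the integrable (x-v)^{e-1}.
    have h1 : (y - v) ^ (H₂ - H₁ - 1) ≤
        (y - x) ^ (2 * (H₂ - H₁) - 1 - e) * (x - v) ^ (e - (H₂ - H₁)) := by
      have e1 : (y - v) ^ (H₂ - H₁ - 1) =
          (y - v) ^ (2 * (H₂ - H₁) - 1 - e) * (y - v) ^ (e - (H₂ - H₁)) := by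
        rw [← Real.rpow_add hyv]; congr 1; ring
      rw [e1]
      exact mul_le_mul (Real.rpow_le_rpow_of_nonpos hyx (by linarith) (by linarith))
        (Real.rpow_le_rpow_of_nonpos hxv (by linarith) (by linarith))
        (Real.rpow_nonneg hyv.le _) (Real.rpow_nonneg hyx.le _)
    have e2 : v ^ (1 - 2 * H₂) = v ^ (1 / 2 - H₂) * v ^ (1 / 2 - H₂) := by
      rw [← Real.rpow_add hv0]; congr 1; ring
    have e3 : (x - v) ^ (e - 1) = (x - v) ^ (H₂ - H₁ - 1) * (x - v) ^ (e - (H₂ - H₁)) := by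
      rw [← Real.rpow_add hxv]; congr 1; ring
    have p1 := Real.rpow_pos_of_pos hv0 (1 / 2 - H₂)
    have p2 := Real.rpow_pos_of_pos hxv (H₂ - H₁ - 1)
    have p3 := Real.rpow_pos_of_pos hx (H₂ - H₁)
    have p4 := Real.rpow_pos_of_pos hy (H₂ - H₁)
    calc dKernelFormula H₁ H₂ x v * dKernelFormula H₁ H₂ y v
        ≤ (C * (v ^ (1 / 2 - H₂) * (x - v) ^ (H₂ - H₁ - 1) * x ^ (H₂ - H₁))) *
          (C * (v ^ (1 / 2 - H₂) * (y - v) ^ (H₂ - H₁ - 1) * y ^ (H₂ - H₁))) :=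
          mul_le_mul (hD v x hv0 hv.2).2 (hD v y hv0 (by linarith)).2
            (hnn y v hv0 (by linarith)) (by positivity)
      _ ≤ (C * (v ^ (1 / 2 - H₂) * (x - v) ^ (H₂ - H₁ - 1) * x ^ (H₂ - H₁))) *
          (C * (v ^ (1 / 2 - H₂) * ((y - x) ^ (2 * (H₂ - H₁) - 1 - e) *
            (x - v) ^ (e - (H₂ - H₁))) * y ^ (H₂ - H₁))) := by gcongr
      _ = A * (v ^ (1 - 2 * H₂) * (x - v) ^ (e - 1)) := by rw [hA, e2, e3]; ring
  have hint : IntegrableOn (fun v => dKernelFormula H₁ H₂ x v * dKernelFormula H₁ H₂ y v)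
      (Ioo 0 x) := by
    refine hgi.mono' ((measurable_dKernelFormula_left x).mul
      (measurable_dKernelFormula_left y)).aestronglyMeasurable ?_
    refine (ae_restrict_iff' measurableSet_Ioo).2 (ae_of_all _ fun v hv => ?_)
    rw [Real.norm_of_nonneg (mul_nonneg (hnn x v hv.1 hv.2) (hnn y v hv.1 (hv.2.trans hxy)))]
    exact hle v hv
  refine ⟨hint, (setIntegral_mono_on hint hgi measurableSet_Ioo hle).trans ?_⟩
  rw [integral_const_mul, integral_rpow_mul_sub_rpow _ _ hx, ← hb]
  have e4 : x ^ (1 - 2 * H₁ - (H₂ - H₁) + e) =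
      x ^ (H₂ - H₁) * x ^ (1 - 2 * H₂ + (e - 1) + 1) := by
    rw [← Real.rpow_add hx]; congr 1; ring
  have hP : 0 ≤ x ^ (1 - 2 * H₁ - (H₂ - H₁) + e) * y ^ (H₂ - H₁) *
      (y - x) ^ (2 * (H₂ - H₁) - 1 - e) := mul_nonneg (mul_nonneg (Real.rpow_nonneg hx.le _)
    (Real.rpow_nonneg hy.le _)) (Real.rpow_nonneg (by linarith) _)
  calc _ = C ^ 2 * b * (x ^ (1 - 2 * H₁ - (H₂ - H₁) + e) * y ^ (H₂ - H₁) *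
      (y - x) ^ (2 * (H₂ - H₁) - 1 - e)) := by rw [e4, hA]; ring
    _ ≤ _ := mul_le_mul_of_nonneg_right (by nlinarith [sq_nonneg C]) hP

/-- The powers of v, x - v and y - v all have negative exponents, so replacing these bases by x, x
and y only decreases the integrand. The resulting constant is integrated over an interval of length
x. -/
theorem exists_le_integral_dKernelFormula (h₁ : H₁ < 1) (h₂ : 1 / 2 < H₂) (h₂' : H₂ < 1)
    (h₁₂ : H₁ < H₂) (hd : H₂ < H₁ + 1) :
    ∃ c : ℝ, 0 < c ∧ ∀ x y : ℝ, 0 < x → x < y →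
      c * (x ^ (1 - 2 * H₁) * y ^ (2 * (H₂ - H₁) - 1)) ≤
        ∫ v in Ioo 0 x, dKernelFormula H₁ H₂ x v * dKernelFormula H₁ H₂ y v := by
  obtain ⟨c, C, hc, hC, hD⟩ := exists_dKernelFormula_bounds h₁ h₂ h₂' h₁₂ hd
  obtain ⟨C', hC', hI⟩ := exists_integral_dKernelFormula_le h₁ h₂ h₂' h₁₂ hd
    (sub_pos.2 h₁₂) le_rfl (by linarith)
  refine ⟨c ^ 2, by positivity, fun x y hx hxy => ?_⟩
  have hy : 0 < y := hx.trans hxy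
  set A := c ^ 2 * (x ^ (1 / 2 - H₂) * x ^ (H₂ - H₁ - 1) * x ^ (H₂ - H₁)) *
    (x ^ (1 / 2 - H₂) * y ^ (H₂ - H₁ - 1) * y ^ (H₂ - H₁)) with hA
  have hle : ∀ v ∈ Ioo 0 x, A ≤ dKernelFormula H₁ H₂ x v * dKernelFormula H₁ H₂ y v := by
    intro v hv
    have hv0 : 0 < v := hv.1
    have hxv : 0 < x - v := sub_pos.2 hv.2
    have hyv : 0 < y - v := by linarith
    have q1 : x ^ (1 / 2 - H₂) ≤ v ^ (1 / 2 - H₂) :=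
      Real.rpow_le_rpow_of_nonpos hv0 hv.2.le (by linarith)
    have q2 : x ^ (H₂ - H₁ - 1) ≤ (x - v) ^ (H₂ - H₁ - 1) :=
      Real.rpow_le_rpow_of_nonpos hxv (by linarith) (by linarith)
    have q3 : y ^ (H₂ - H₁ - 1) ≤ (y - v) ^ (H₂ - H₁ - 1) :=
      Real.rpow_le_rpow_of_nonpos hyv (by linarith) (by linarith)
    have p1 := Real.rpow_pos_of_pos hx (1 / 2 - H₂)
    have p2 := Real.rpow_pos_of_pos hx (H₂ - H₁ - 1)
    have p3 := Real.rpow_pos_of_pos hx (H₂ - H₁)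
    have p4 := Real.rpow_pos_of_pos hy (H₂ - H₁)
    have p5 := Real.rpow_pos_of_pos hy (H₂ - H₁ - 1)
    calc A = (c * (x ^ (1 / 2 - H₂) * x ^ (H₂ - H₁ - 1) * x ^ (H₂ - H₁))) *
          (c * (x ^ (1 / 2 - H₂) * y ^ (H₂ - H₁ - 1) * y ^ (H₂ - H₁))) := by rw [hA]; ring
      _ ≤ (c * (v ^ (1 / 2 - H₂) * (x - v) ^ (H₂ - H₁ - 1) * x ^ (H₂ - H₁))) *
          (c * (v ^ (1 / 2 - H₂) * (y - v) ^ (H₂ - H₁ - 1) * y ^ (H₂ - H₁))) := by gcongr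
      _ ≤ _ := by
        have r1 := (hD v x hv0 hv.2).1
        have r2 := (hD v y hv0 (by linarith)).1
        have r3 : 0 ≤ c * (v ^ (1 / 2 - H₂) * (y - v) ^ (H₂ - H₁ - 1) * y ^ (H₂ - H₁)) := by
          positivity
        have r4 : 0 ≤ c * (v ^ (1 / 2 - H₂) * (x - v) ^ (H₂ - H₁ - 1) * x ^ (H₂ - H₁)) := by
          positivity
        exact mul_le_mul r1 r2 r3 (r4.trans r1)
  have hci : IntegrableOn (fun _ : ℝ => A) (Ioo 0 x) := by simp
  have h := setIntegral_mono_on hci (hI x y hx hxy).1 measurableSet_Ioo hle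
  refine le_trans (le_of_eq ?_) h
  rw [setIntegral_const, measureReal_def, Real.volume_Ioo, sub_zero, ENNReal.toReal_ofReal hx.le,
    smul_eq_mul, hA]
  have e1 : x ^ (1 - 2 * H₁) = x * (x ^ (1 / 2 - H₂) * x ^ (H₂ - H₁ - 1) * x ^ (H₂ - H₁)) *
      x ^ (1 / 2 - H₂) := by
    nth_rewrite 2 [← Real.rpow_one x]
    rw [← Real.rpow_add hx, ← Real.rpow_add hx, ← Real.rpow_add hx, ← Real.rpow_add hx]
    congr 1; ring
  have e2 : y ^ (2 * (H₂ - H₁) - 1) = y ^ (H₂ - H₁ - 1) * y ^ (H₂ - H₁) := by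
    rw [← Real.rpow_add hy]; congr 1; ring
  rw [e1, e2]; ring

/-! ### The weighted kernel as a Gram kernel, and its bounds -/

/-- The factor `s^{H₁-1/2} ∂_s K(s,v)`, extended by zero outside `0 < v < s`. -/
noncomputable def kernelFactor (H₁ H₂ s v : ℝ) : ℝ :=
  {z : ℝ × ℝ | 0 < z.2 ∧ z.2 < z.1}.indicator
    (fun z => z.1 ^ (H₁ - 1 / 2) * dKernelFormula H₁ H₂ z.1 z.2) (s, v)

/-- The kernel `s^{H₁-1/2} u^{H₁-1/2} k(s,u)`. -/
noncomputable def weightedKernel (H₁ H₂ s u : ℝ) : ℝ :=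
  ∫ v, kernelFactor H₁ H₂ s v * kernelFactor H₁ H₂ u v

lemma measurable_kernelFactor : Measurable (fun z : ℝ × ℝ => kernelFactor H₁ H₂ z.1 z.2) := by
  have hm := measurable_dKernelFormula (H₁ := H₁) (H₂ := H₂)
  refine Measurable.indicator (by fun_prop) ?_
  exact (measurableSet_lt measurable_const measurable_snd).inter
    (measurableSet_lt measurable_snd measurable_fst)

lemma measurable_weightedKernel :
    Measurable (fun z : ℝ × ℝ => weightedKernel H₁ H₂ z.1 z.2) := by
  have h1 : Measurable (fun w : (ℝ × ℝ) × ℝ => kernelFactor H₁ H₂ w.1.1 w.2) :=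
    measurable_kernelFactor.comp (measurable_fst.fst.prodMk measurable_snd)
  have h2 : Measurable (fun w : (ℝ × ℝ) × ℝ => kernelFactor H₁ H₂ w.1.2 w.2) :=
    measurable_kernelFactor.comp (measurable_fst.snd.prodMk measurable_snd)
  exact ((h1.mul h2).stronglyMeasurable.integral_prod_right' (ν := volume)).measurable

lemma weightedKernel_comm (s u : ℝ) : weightedKernel H₁ H₂ s u = weightedKernel H₁ H₂ u s := by
  unfold weightedKernel
  simp_rw [mul_comm]

/-- The supports of the two factors meet exactly in (0, s ∧ u). Extension by zero thus makes the
domain of integration independent of s and u, as the Gram form needs. -/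
lemma kernelFactor_mul_eq (s u : ℝ) :
    (fun v => kernelFactor H₁ H₂ s v * kernelFactor H₁ H₂ u v) =
      (Ioo 0 (min s u)).indicator (fun v => s ^ (H₁ - 1 / 2) * u ^ (H₁ - 1 / 2) *
        (dKernelFormula H₁ H₂ s v * dKernelFormula H₁ H₂ u v)) := by
  funext v
  by_cases hv : v ∈ Ioo 0 (min s u)
  · obtain ⟨h0, h1⟩ := hv
    have h2 := lt_min_iff.1 h1
    simp only [kernelFactor, indicator, mem_ofPred_eq, h0, h1, h2.1, h2.2, mem_Ioo, and_self,
      if_true]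
    ring
  · rw [indicator_of_notMem hv]
    simp only [kernelFactor, indicator, mem_ofPred_eq]
    simp only [mem_Ioo, lt_min_iff, not_and] at hv
    by_cases h0 : 0 < v <;> by_cases h1 : v < s <;> simp_all

lemma weightedKernel_eq (s u : ℝ) :
    weightedKernel H₁ H₂ s u = s ^ (H₁ - 1 / 2) * u ^ (H₁ - 1 / 2) *
      ∫ v in Ioo 0 (min s u), dKernelFormula H₁ H₂ s v * dKernelFormula H₁ H₂ u v := by
  unfold weightedKernel
  rw [kernelFactor_mul_eq, integral_indicator measurableSet_Ioo, integral_const_mul]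

lemma weightedKernel_eq_kernelk (h₁ : H₁ < 1) (h₂ : 1 / 2 < H₂) (h₁₂ : H₁ < H₂)
    (hd : H₂ < H₁ + 1) (s u : ℝ) :
    weightedKernel H₁ H₂ s u =
      s ^ (H₁ - 1 / 2) * u ^ (H₁ - 1 / 2) * kernelk H₁ H₂ s u := by
  rw [weightedKernel_eq, kernelk]
  congr 1
  refine setIntegral_congr_fun measurableSet_Ioo fun v hv => ?_
  have h := lt_min_iff.1 hv.2
  rw [dKernelK_eq h₁ h₂ h₁₂ hd hv.1 h.1, dKernelK_eq h₁ h₂ h₁₂ hd hv.1 h.2]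

lemma kernelFactor_nonneg (h₁ : H₁ < 1) (h₂ : 1 / 2 < H₂) (h₂' : H₂ < 1)
    (h₁₂ : H₁ < H₂) (hd : H₂ < H₁ + 1) (s v : ℝ) : 0 ≤ kernelFactor H₁ H₂ s v := by
  obtain ⟨c, C, hc, hC, hD⟩ := exists_dKernelFormula_bounds h₁ h₂ h₂' h₁₂ hd
  refine indicator_apply_nonneg fun h => ?_
  obtain ⟨hv, hvs⟩ : 0 < v ∧ v < s := h
  refine mul_nonneg (Real.rpow_nonneg (hv.trans hvs).le _) ((hD v s hv hvs).1.trans' ?_)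
  exact mul_nonneg hc.le (mul_nonneg (mul_nonneg (Real.rpow_nonneg hv.le _)
      (Real.rpow_nonneg (by linarith) _)) (Real.rpow_nonneg (by linarith) _))

lemma weightedKernel_nonneg (h₁ : H₁ < 1) (h₂ : 1 / 2 < H₂) (h₂' : H₂ < 1)
    (h₁₂ : H₁ < H₂) (hd : H₂ < H₁ + 1) (s u : ℝ) : 0 ≤ weightedKernel H₁ H₂ s u :=
  integral_nonneg fun v => mul_nonneg (kernelFactor_nonneg h₁ h₂ h₂' h₁₂ hd s v)
    (kernelFactor_nonneg h₁ h₂ h₂' h₁₂ hd u v)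

lemma integrable_kernelFactor_mul (h₁ : H₁ < 1) (h₂ : 1 / 2 < H₂) (h₂' : H₂ < 1)
    (h₁₂ : H₁ < H₂) (hd : H₂ < H₁ + 1) {s u : ℝ} (hs : 0 < s) (hu : 0 < u) (hsu : s ≠ u) :
    Integrable (fun v => kernelFactor H₁ H₂ s v * kernelFactor H₁ H₂ u v) := by
  obtain ⟨C', hC', hI⟩ := exists_integral_dKernelFormula_le h₁ h₂ h₂' h₁₂ hd
    (sub_pos.2 h₁₂) le_rfl (by linarith)
  rw [kernelFactor_mul_eq, integrable_indicator_iff measurableSet_Ioo]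
  refine Integrable.const_mul ?_ _
  rcases lt_or_gt_of_ne hsu with h | h
  · rw [min_eq_left h.le]; exact (hI s u hs h).1
  · rw [min_eq_right h.le]
    exact (hI u s hu h).1.congr_fun (fun v _ => mul_comm _ _) measurableSet_Ioo

/-- Needed for uniqueness: as a function of s the bound is a multiple of the weight w, so one
convergent integral controls a weighted L¹ norm of the solution. -/
theorem exists_le_weightedKernel (h₁' : 1 / 2 < H₁) (h₁ : H₁ < 1) (h₂ : 1 / 2 < H₂) (h₂' : H₂ < 1)
    (h₁₂ : H₁ < H₂) {T : ℝ} (hT : 0 < T) :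
    ∃ c : ℝ, 0 < c ∧ ∀ s u : ℝ, s ∈ Ioc 0 T → u ∈ Ioc 0 T → s ≠ u →
      c * (s ^ (1 / 2 - H₁) * u ^ (H₁ - 1 / 2)) ≤ weightedKernel H₁ H₂ s u := by
  obtain ⟨c, hc, hI⟩ := exists_le_integral_dKernelFormula h₁ h₂ h₂' h₁₂ (by linarith)
  refine ⟨c * T ^ (2 * (H₂ - H₁) - 1), mul_pos hc (Real.rpow_pos_of_pos hT _),
    fun s u hs hu hsu => ?_⟩
  have key : c * (s ^ (1 - 2 * H₁) * T ^ (2 * (H₂ - H₁) - 1)) ≤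
      ∫ v in Ioo 0 (min s u), dKernelFormula H₁ H₂ s v * dKernelFormula H₁ H₂ u v := by
    rcases lt_or_gt_of_ne hsu with h | h
    · rw [min_eq_left h.le]
      refine le_trans ?_ (hI s u hs.1 h)
      have := Real.rpow_le_rpow_of_nonpos (z := 2 * (H₂ - H₁) - 1) hu.1 hu.2 (by linarith)
      have := Real.rpow_pos_of_pos hs.1 (1 - 2 * H₁)
      gcongr
    · rw [min_eq_right h.le]
      simp_rw [mul_comm (dKernelFormula H₁ H₂ s _)]
      refine le_trans ?_ (hI u s hu.1 h)
      have h1 := Real.rpow_le_rpow_of_nonpos (z := 2 * (H₂ - H₁) - 1) hs.1 hs.2 (by linarith)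
      have h2 := Real.rpow_le_rpow_of_nonpos (z := 1 - 2 * H₁) hu.1 h.le (by linarith)
      have := Real.rpow_pos_of_pos hu.1 (1 - 2 * H₁)
      have := Real.rpow_pos_of_pos hT (2 * (H₂ - H₁) - 1)
      gcongr
  rw [weightedKernel_eq]
  have e1 : s ^ (1 / 2 - H₁) = s ^ (H₁ - 1 / 2) * s ^ (1 - 2 * H₁) := by
    rw [← Real.rpow_add hs.1]; congr 1; ring
  have hp : 0 ≤ s ^ (H₁ - 1 / 2) * u ^ (H₁ - 1 / 2) :=
    mul_nonneg (Real.rpow_nonneg hs.1.le _) (Real.rpow_nonneg hu.1.le _)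
  calc _ = s ^ (H₁ - 1 / 2) * u ^ (H₁ - 1 / 2) *
        (c * (s ^ (1 - 2 * H₁) * T ^ (2 * (H₂ - H₁) - 1))) := by rw [e1]; ring
    _ ≤ _ := mul_le_mul_of_nonneg_left key hp

/-- Away from the diagonal the weighted kernel has a product bound, near it a convolution bound. -/
lemma exists_weightedKernel_le_or (h₁' : 1 / 2 < H₁) (h₁ : H₁ < 1) (h₂ : 1 / 2 < H₂)
    (h₂' : H₂ < 1) (h₁₂ : H₁ < H₂) {p : ℝ} (hp : 1 - 2 * (H₂ - H₁) < p)
    (hp' : p ≤ 1 - (H₂ - H₁)) {T : ℝ} (hT : 0 < T) :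
    ∃ C : ℝ, 0 < C ∧ ∀ x y : ℝ, 0 < x → x < y → y ≤ T →
      weightedKernel H₁ H₂ x y ≤ C * (x ^ (1 / 2 - H₁) * y ^ (-p)) ∨
      weightedKernel H₁ H₂ x y ≤ C * (y - x) ^ (-p) := by
  obtain ⟨C₁, hC₁, hI₁⟩ := exists_integral_dKernelFormula_le h₁ h₂ h₂' h₁₂ (by linarith)
    (sub_pos.2 h₁₂) le_rfl (by linarith)
  obtain ⟨C₂, hC₂, hI₂⟩ := exists_integral_dKernelFormula_le h₁ h₂ h₂' h₁₂ (by linarith)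
    (e := 2 * (H₂ - H₁) - 1 + p) (by linarith) (by linarith) (by linarith)
  set D₁ := C₁ * ((1 / 2) ^ (H₂ - H₁ - 1) * T ^ (H₁ - 1 / 2 + 2 * (H₂ - H₁) - 1 + p)) with hD₁
  set D₂ := C₂ * ((1 / 2) ^ (-(H₂ - 1 / 2)) * T ^ (2 * (H₂ - H₁) - 1 + p)) with hD₂
  have hD₁0 : 0 < D₁ := by positivity
  have hD₂0 : 0 < D₂ := by positivity
  refine ⟨max D₁ D₂, lt_max_of_lt_left hD₁0, fun x y hx hxy hyT => ?_⟩
  have hy : 0 < y := hx.trans hxy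
  have hyx : 0 < y - x := sub_pos.2 hxy
  have hw : weightedKernel H₁ H₂ x y = x ^ (H₁ - 1 / 2) * y ^ (H₁ - 1 / 2) *
      ∫ v in Ioo 0 x, dKernelFormula H₁ H₂ x v * dKernelFormula H₁ H₂ y v := by
    rw [weightedKernel_eq, min_eq_left hxy.le]
  have hxa : 0 < x ^ (H₁ - 1 / 2) := Real.rpow_pos_of_pos hx _
  have hya : 0 < y ^ (H₁ - 1 / 2) := Real.rpow_pos_of_pos hy _
  have hyd : 0 < y ^ (H₂ - H₁) := Real.rpow_pos_of_pos hy _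
  -- Far from the diagonal y - x ≥ y/2, and e = d gives the mildest singularity at the origin. Near
  -- it x and y are comparable, and e = 2d - 1 + p leaves exactly (y-x)^{-p}, the factors
  -- x^{-(H₂-1/2)} and y^{H₂-1/2} compensating each other.
  rcases le_total x (y / 2) with hfar | hnear
  · left
    have hP : 0 ≤ x ^ (1 / 2 - H₁) * y ^ (-p) :=
      mul_nonneg (Real.rpow_nonneg hx.le _) (Real.rpow_nonneg hy.le _)
    refine le_trans ?_ (mul_le_mul_of_nonneg_right (le_max_left D₁ D₂) hP)
    rw [hw]
    have hb := (hI₁ x y hx hxy).2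
    have e0 : 2 * (H₂ - H₁) - 1 - (H₂ - H₁) = H₂ - H₁ - 1 := by ring
    have e0' : 1 - 2 * H₁ - (H₂ - H₁) + (H₂ - H₁) = 1 - 2 * H₁ := by ring
    rw [e0, e0'] at hb
    have hdist : (y - x) ^ (H₂ - H₁ - 1) ≤ (1 / 2) ^ (H₂ - H₁ - 1) * y ^ (H₂ - H₁ - 1) := by
      rw [← Real.mul_rpow (by norm_num) hy.le]
      exact Real.rpow_le_rpow_of_nonpos (by linarith) (by linarith) (by linarith)
    have hyT' : y ^ (H₁ - 1 / 2 + 2 * (H₂ - H₁) - 1 + p) ≤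
        T ^ (H₁ - 1 / 2 + 2 * (H₂ - H₁) - 1 + p) :=
      Real.rpow_le_rpow hy.le hyT (by linarith)
    have ex : x ^ (1 / 2 - H₁) = x ^ (H₁ - 1 / 2) * x ^ (1 - 2 * H₁) := by
      rw [← Real.rpow_add hx]; congr 1; ring
    have ey : y ^ (H₁ - 1 / 2) * y ^ (H₂ - H₁) * y ^ (H₂ - H₁ - 1) =
        y ^ (-p) * y ^ (H₁ - 1 / 2 + 2 * (H₂ - H₁) - 1 + p) := by
      rw [← Real.rpow_add hy, ← Real.rpow_add hy, ← Real.rpow_add hy]; congr 1; ring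
    have q1 : 0 < x ^ (1 - 2 * H₁) := Real.rpow_pos_of_pos hx _
    have q2 : 0 < y ^ (-p) := Real.rpow_pos_of_pos hy _
    calc _ ≤ x ^ (H₁ - 1 / 2) * y ^ (H₁ - 1 / 2) * (C₁ * (x ^ (1 - 2 * H₁) * y ^ (H₂ - H₁) *
          ((1 / 2) ^ (H₂ - H₁ - 1) * y ^ (H₂ - H₁ - 1)))) := by
          refine mul_le_mul_of_nonneg_left (hb.trans ?_) (by positivity)
          gcongr
      _ = C₁ * (1 / 2) ^ (H₂ - H₁ - 1) * x ^ (1 / 2 - H₁) *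
          (y ^ (H₁ - 1 / 2) * y ^ (H₂ - H₁) * y ^ (H₂ - H₁ - 1)) := by rw [ex]; ring
      _ ≤ C₁ * (1 / 2) ^ (H₂ - H₁ - 1) * x ^ (1 / 2 - H₁) *
          (y ^ (-p) * T ^ (H₁ - 1 / 2 + 2 * (H₂ - H₁) - 1 + p)) := by rw [ey]; gcongr
      _ = _ := by rw [hD₁]; ring
  · right
    have hP : 0 ≤ (y - x) ^ (-p) := Real.rpow_nonneg hyx.le _
    refine le_trans ?_ (mul_le_mul_of_nonneg_right (le_max_right D₁ D₂) hP)
    rw [hw]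
    have hb := (hI₂ x y hx hxy).2
    have e0 : 2 * (H₂ - H₁) - 1 - (2 * (H₂ - H₁) - 1 + p) = -p := by ring
    rw [e0] at hb
    have ex : x ^ (H₁ - 1 / 2) * x ^ (1 - 2 * H₁ - (H₂ - H₁) + (2 * (H₂ - H₁) - 1 + p)) =
        x ^ (-(H₂ - 1 / 2)) * x ^ (2 * (H₂ - H₁) - 1 + p) := by
      rw [← Real.rpow_add hx, ← Real.rpow_add hx]; congr 1; ring
    have h1 : x ^ (-(H₂ - 1 / 2)) ≤ (1 / 2) ^ (-(H₂ - 1 / 2)) * y ^ (-(H₂ - 1 / 2)) := by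
      rw [← Real.mul_rpow (by norm_num) hy.le]
      exact Real.rpow_le_rpow_of_nonpos (by linarith) (by linarith) (by linarith)
    have h2 : x ^ (2 * (H₂ - H₁) - 1 + p) ≤ T ^ (2 * (H₂ - H₁) - 1 + p) :=
      Real.rpow_le_rpow hx.le (by linarith) (by linarith)
    have ey : y ^ (-(H₂ - 1 / 2)) * (y ^ (H₁ - 1 / 2) * y ^ (H₂ - H₁)) = 1 := by
      rw [← Real.rpow_add hy, ← Real.rpow_add hy]
      convert Real.rpow_zero y using 2; ring
    have q1 : 0 ≤ x ^ (2 * (H₂ - H₁) - 1 + p) := Real.rpow_nonneg hx.le _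
    have q2 : 0 ≤ y ^ (-(H₂ - 1 / 2)) := Real.rpow_nonneg hy.le _
    calc _ ≤ x ^ (H₁ - 1 / 2) * y ^ (H₁ - 1 / 2) *
          (C₂ * (x ^ (1 - 2 * H₁ - (H₂ - H₁) + (2 * (H₂ - H₁) - 1 + p)) * y ^ (H₂ - H₁) *
            (y - x) ^ (-p))) := mul_le_mul_of_nonneg_left hb (by positivity)
      _ = C₂ * (x ^ (H₁ - 1 / 2) * x ^ (1 - 2 * H₁ - (H₂ - H₁) + (2 * (H₂ - H₁) - 1 + p))) *
          (y ^ (H₁ - 1 / 2) * y ^ (H₂ - H₁)) * (y - x) ^ (-p) := by ring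
      _ ≤ C₂ * (((1 / 2) ^ (-(H₂ - 1 / 2)) * y ^ (-(H₂ - 1 / 2))) *
            T ^ (2 * (H₂ - H₁) - 1 + p)) *
          (y ^ (H₁ - 1 / 2) * y ^ (H₂ - H₁)) * (y - x) ^ (-p) := by rw [ex]; gcongr
      _ = C₂ * ((1 / 2) ^ (-(H₂ - 1 / 2)) * T ^ (2 * (H₂ - H₁) - 1 + p)) *
          (y ^ (-(H₂ - 1 / 2)) * (y ^ (H₁ - 1 / 2) * y ^ (H₂ - H₁))) * (y - x) ^ (-p) := by ring
      _ = _ := by rw [ey, hD₂]; ring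

/-- The bound is deliberately asymmetric: s, the variable integrated against the unknown, carries
the weight, and the remaining factor has uniformly square integrable rows when p < 1/2. -/
theorem exists_weightedKernel_le (h₁' : 1 / 2 < H₁) (h₁ : H₁ < 1) (h₂ : 1 / 2 < H₂)
    (h₂' : H₂ < 1) (h₁₂ : H₁ < H₂) {p : ℝ} (hp : 1 - 2 * (H₂ - H₁) < p)
    (hp' : p ≤ 1 - (H₂ - H₁)) {T : ℝ} (hT : 0 < T) :
    ∃ C : ℝ, 0 < C ∧ ∀ s u : ℝ, s ∈ Ioc 0 T → u ∈ Ioc 0 T → s ≠ u →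
      weightedKernel H₁ H₂ s u ≤ s ^ (1 / 2 - H₁) * (C * (|0 - u| ^ (-p) + |s - u| ^ (-p))) := by
  obtain ⟨C, hC, hI⟩ := exists_weightedKernel_le_or h₁' h₁ h₂ h₂' h₁₂ hp hp' hT
  have hTa : 0 < T ^ (H₁ - 1 / 2) := Real.rpow_pos_of_pos hT _
  refine ⟨C * max 1 (T ^ (H₁ - 1 / 2)), by positivity, fun s u hs hu hsu => ?_⟩
  have hsa : 0 < s ^ (1 / 2 - H₁) := Real.rpow_pos_of_pos hs.1 _
  have hup : 0 < u ^ (-p) := Real.rpow_pos_of_pos hu.1 _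
  have hsup : 0 ≤ |s - u| ^ (-p) := Real.rpow_nonneg (abs_nonneg _) _
  -- The weight is bounded below on (0,T], so the near-diagonal bound can absorb it at the cost of a
  -- constant.
  have hone : 1 ≤ T ^ (H₁ - 1 / 2) * s ^ (1 / 2 - H₁) := by
    have h3 : T ^ (1 / 2 - H₁) ≤ s ^ (1 / 2 - H₁) :=
      Real.rpow_le_rpow_of_nonpos hs.1 hs.2 (by linarith)
    have h4 : T ^ (H₁ - 1 / 2) * T ^ (1 / 2 - H₁) = 1 := by
      rw [← Real.rpow_add hT]; convert Real.rpow_zero T using 2; ring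
    nlinarith
  have hfar : ∀ K : ℝ, K ≤ C * (s ^ (1 / 2 - H₁) * u ^ (-p)) → K ≤ s ^ (1 / 2 - H₁) *
      (C * max 1 (T ^ (H₁ - 1 / 2)) * (u ^ (-p) + |s - u| ^ (-p))) := by
    intro K hK
    calc K ≤ s ^ (1 / 2 - H₁) * (C * 1 * (u ^ (-p) + 0)) := by linarith
      _ ≤ _ := by gcongr; exact le_max_left _ _
  have hnear : ∀ K : ℝ, K ≤ C * |s - u| ^ (-p) → K ≤ s ^ (1 / 2 - H₁) *
      (C * max 1 (T ^ (H₁ - 1 / 2)) * (u ^ (-p) + |s - u| ^ (-p))) := by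
    intro K hK
    have h5 : 0 ≤ C * |s - u| ^ (-p) := by positivity
    calc K ≤ s ^ (1 / 2 - H₁) * (C * T ^ (H₁ - 1 / 2) * (0 + |s - u| ^ (-p))) := by nlinarith
      _ ≤ _ := by gcongr; exact le_max_right _ _
  rw [zero_sub, abs_neg, abs_of_pos hu.1]
  rcases lt_or_gt_of_ne hsu with h | h
  · rcases hI s u hs.1 h hu.2 with h' | h'
    · exact hfar _ h'
    · refine hnear _ ?_
      rwa [abs_sub_comm, abs_of_pos (sub_pos.2 h)]
  · rw [weightedKernel_comm]
    rcases hI u s hu.1 h hs.2 with h' | h'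
    · refine hfar _ (h'.trans ?_)
      refine mul_le_mul_of_nonneg_left ?_ hC.le
      have e1 : s ^ (-p) = s ^ (1 / 2 - H₁) * s ^ (H₁ - 1 / 2 - p) := by
        rw [← Real.rpow_add hs.1]; congr 1; ring
      have e2 : u ^ (-p) = u ^ (1 / 2 - H₁) * u ^ (H₁ - 1 / 2 - p) := by
        rw [← Real.rpow_add hu.1]; congr 1; ring
      -- The exponent is negative: p > 1 - 2d gives H₁ - 1/2 - p < 2H₂ - H₁ - 3/2 < 0. This moves
      -- the weight from the smaller variable u to s.
      have h6 : s ^ (H₁ - 1 / 2 - p) ≤ u ^ (H₁ - 1 / 2 - p) :=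
        Real.rpow_le_rpow_of_nonpos hu.1 h.le (by linarith)
      have hua : 0 < u ^ (1 / 2 - H₁) := Real.rpow_pos_of_pos hu.1 _
      rw [e1, e2]
      calc _ = s ^ (1 / 2 - H₁) * (u ^ (1 / 2 - H₁) * s ^ (H₁ - 1 / 2 - p)) := by ring
        _ ≤ _ := by gcongr
    · refine hnear _ ?_
      rwa [abs_of_pos (sub_pos.2 h)]

end

/-! ### Square integrability of the rows and the weighted equation -/

section

variable {H₁ H₂ : ℝ}

lemma lintegral_abs_rpow_sq_lt_top {p : ℝ} (hp : p < 1 / 2) (T : ℝ) :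
    ∫⁻ v in Icc (-T) T, ENNReal.ofReal (|v| ^ (-p)) ^ 2 < ⊤ := by
  have h1 : ∀ a b : ℝ, IntervalIntegrable (fun v : ℝ => |v| ^ (-(2 * p))) volume a b := by
    have hpos : ∀ b : ℝ, 0 ≤ b →
        IntervalIntegrable (fun v : ℝ => |v| ^ (-(2 * p))) volume 0 b := by
      intro b hb
      have h := intervalIntegral.intervalIntegrable_rpow' (a := 0) (b := b) (r := -(2 * p))
        (by linarith)
      refine h.congr fun v hv => ?_
      rw [uIoc_of_le hb] at hv
      simp only [abs_of_pos hv.1]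
    have hall : ∀ b : ℝ, IntervalIntegrable (fun v : ℝ => |v| ^ (-(2 * p))) volume 0 b := by
      intro b
      rcases le_total 0 b with hb | hb
      · exact hpos b hb
      · have h := (hpos (-b) (by linarith))
        rw [IntervalIntegrable.iff_comp_neg] at h
        simpa using h
    exact fun a b => (hall a).symm.trans (hall b)
  rcases lt_or_ge T 0 with hT | hT
  · rw [Icc_eq_empty (by linarith)]; simp
  have h2 := (intervalIntegrable_iff_integrableOn_Icc_of_le (by linarith)).1 (h1 (-T) T)
  refine lt_of_le_of_lt (le_of_eq ?_) h2.2
  refine lintegral_congr fun v => ?_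
  have h0 : 0 ≤ |v| ^ (-p) := Real.rpow_nonneg (abs_nonneg v) _
  rw [Real.enorm_eq_ofReal (Real.rpow_nonneg (abs_nonneg v) _), ← ENNReal.ofReal_pow h0,
    ← Real.rpow_mul_natCast (abs_nonneg v)]
  congr 2
  push_cast; ring

/-- Translation by s carries (0,T] into [-T,T], whatever s is. The value s = 0 is included so that
|0 - u|^{-p} is covered too. -/
lemma lintegral_abs_sub_rpow_sq_le (p : ℝ) {s T : ℝ} (hs : s ∈ Icc 0 T) :
    ∫⁻ u in Ioc 0 T, ENNReal.ofReal (|s - u| ^ (-p)) ^ 2 ≤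
      ∫⁻ v in Icc (-T) T, ENNReal.ofReal (|v| ^ (-p)) ^ 2 := by
  rw [← lintegral_indicator measurableSet_Ioc, ← lintegral_indicator measurableSet_Icc,
    ← lintegral_sub_left_eq_self ((Icc (-T) T).indicator _) s]
  refine lintegral_mono fun u => ?_
  by_cases hu : u ∉ Ioc 0 T
  · rw [indicator_of_notMem hu]; exact zero_le
  rw [not_not] at hu
  rw [indicator_of_mem hu]
  have hmem : s - u ∈ Icc (-T) T := ⟨by linarith [hs.1, hu.2], by linarith [hs.2, hu.1]⟩
  rw [indicator_of_mem hmem]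

/-- Uniform square integrability of the rows of the dominating kernel. -/
lemma exists_lintegral_row_le {p : ℝ} (hp : p < 1 / 2) (C T : ℝ) :
    ∃ M : ENNReal, M ≠ ⊤ ∧ ∀ s ∈ Ioc 0 T, ∫⁻ u in Ioc 0 T,
      ENNReal.ofReal (C * (|0 - u| ^ (-p) + |s - u| ^ (-p))) ^ 2 ≤ M := by
  set I := ∫⁻ v in Icc (-T) T, ENNReal.ofReal (|v| ^ (-p)) ^ 2 with hI
  have hItop : I ≠ ⊤ := (lintegral_abs_rpow_sq_lt_top hp T).ne
  refine ⟨ENNReal.ofReal C ^ 2 * (2 * (I + I)), by finiteness, fun s hs => ?_⟩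
  have hmeas : ∀ s : ℝ, Measurable fun u : ℝ => ENNReal.ofReal (|s - u| ^ (-p)) ^ 2 := by
    intro s; fun_prop
  calc ∫⁻ u in Ioc 0 T, ENNReal.ofReal (C * (|0 - u| ^ (-p) + |s - u| ^ (-p))) ^ 2
      ≤ ∫⁻ u in Ioc 0 T, ENNReal.ofReal C ^ 2 * (2 * (ENNReal.ofReal (|0 - u| ^ (-p)) ^ 2 +
          ENNReal.ofReal (|s - u| ^ (-p)) ^ 2)) := by
        refine lintegral_mono fun u => ?_
        have h1 : 0 ≤ |0 - u| ^ (-p) := Real.rpow_nonneg (abs_nonneg _) _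
        have h2 : 0 ≤ |s - u| ^ (-p) := Real.rpow_nonneg (abs_nonneg _) _
        rw [ENNReal.ofReal_mul' (by positivity), mul_pow]
        gcongr
        rw [← ENNReal.ofReal_pow (by positivity), ← ENNReal.ofReal_pow h1,
          ← ENNReal.ofReal_pow h2, ← ENNReal.ofReal_add (by positivity) (by positivity),
          show (2 : ENNReal) = ENNReal.ofReal 2 by norm_num,
          ← ENNReal.ofReal_mul (by norm_num)]
        exact ENNReal.ofReal_le_ofReal (add_sq_le)
    _ = ENNReal.ofReal C ^ 2 * (2 * ((∫⁻ u in Ioc 0 T, ENNReal.ofReal (|0 - u| ^ (-p)) ^ 2) +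
          ∫⁻ u in Ioc 0 T, ENNReal.ofReal (|s - u| ^ (-p)) ^ 2)) := by
        rw [lintegral_const_mul' _ _ (by finiteness), lintegral_const_mul' _ _ (by finiteness),
          lintegral_add_left (hmeas 0)]
    _ ≤ _ := by
        gcongr
        · exact lintegral_abs_sub_rpow_sq_le p ⟨le_rfl, hs.1.le.trans hs.2⟩
        · exact lintegral_abs_sub_rpow_sq_le p ⟨hs.1.le, hs.2⟩

lemma memLp_two_rpow {r : ℝ} (hr : -1 / 2 < r) (T : ℝ) :
    MemLp (fun t : ℝ => t ^ r) 2 (volume.restrict (Ioc 0 T)) := by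
  have hm : AEStronglyMeasurable (fun t : ℝ => t ^ r) (volume.restrict (Ioc 0 T)) :=
    Measurable.aestronglyMeasurable (by fun_prop)
  rw [memLp_two_iff_integrable_sq hm]
  rcases le_total T 0 with hT | hT
  · simp [Ioc_eq_empty (not_lt.2 hT)]
  have h := intervalIntegral.intervalIntegrable_rpow' (a := 0) (b := T) (r := r * 2)
    (by linarith)
  rw [intervalIntegrable_iff_integrableOn_Ioc_of_le hT] at h
  refine h.congr_fun (fun t ht => ?_) measurableSet_Ioc
  simp only
  rw [Real.rpow_mul ht.1.le]; norm_num

lemma ae_ne_restrict (S : Set ℝ) (u : ℝ) : ∀ᵐ s ∂(volume.restrict S), s ≠ u :=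
  ae_restrict_of_ae (by simp [ae_iff])

/-- The integral equation in terms of the weighted unknown `h(s) s^{1/2-H₁}`. -/
lemma solvesAt_iff (h₁ : H₁ < 1) (h₂ : 1 / 2 < H₂) (h₁₂ : H₁ < H₂)
    (hd : H₂ < H₁ + 1) {T u : ℝ} (hu : u ∈ Ioc 0 T) (h : ℝ → ℝ) :
    SolvesAt H₁ H₂ T h u ↔
      IntegrableOn (fun s => h s * s ^ (1 / 2 - H₁) * weightedKernel H₁ H₂ s u) (Ioc 0 T) ∧
      gammaH H₁ ^ 2 * u ^ (1 / 2 - H₁) = gammaH H₁ ^ 2 * (h u * u ^ (1 / 2 - H₁)) +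
        ∫ s in Ioc 0 T, h s * s ^ (1 / 2 - H₁) * weightedKernel H₁ H₂ s u := by
  have hua : 0 < u ^ (H₁ - 1 / 2) := Real.rpow_pos_of_pos hu.1 _
  have hpt : ∀ s ∈ Ioc 0 T, h s * s ^ (1 / 2 - H₁) * weightedKernel H₁ H₂ s u =
      u ^ (H₁ - 1 / 2) * (h s * kernelk H₁ H₂ s u) := by
    intro s hs
    have e : s ^ (1 / 2 - H₁) * s ^ (H₁ - 1 / 2) = 1 := by
      rw [← Real.rpow_add hs.1]; convert Real.rpow_zero s using 2; ring
    rw [weightedKernel_eq_kernelk h₁ h₂ h₁₂ hd]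
    linear_combination (h s * u ^ (H₁ - 1 / 2) * kernelk H₁ H₂ s u) * e
  have e : u ^ (1 / 2 - H₁) = u ^ (H₁ - 1 / 2) * u ^ (1 - 2 * H₁) := by
    rw [← Real.rpow_add hu.1]; congr 1; ring
  rw [setIntegral_congr_fun measurableSet_Ioc hpt, integral_const_mul,
    integrableOn_congr_fun hpt measurableSet_Ioc, IntegrableOn,
    integrable_const_mul_iff hua.ne'.isUnit, e]
  unfold SolvesAt IntegrableOn
  refine and_congr_right fun _ => ⟨fun h => ?_, fun h => ?_⟩
  · linear_combination u ^ (H₁ - 1 / 2) * h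
  · exact mul_left_cancel₀ hua.ne' (by linear_combination h)

/-! ### Existence and uniqueness at every horizon -/

/-- For every horizon `T > 0` the integral equation has a solution, which is unique almost
everywhere. -/
theorem exists_unique_solution (h₁ : 1 / 2 < H₁) (h₂ : H₂ < 1) (hgap : 1 / 4 < H₂ - H₁)
    {T : ℝ} (hT : 0 < T) :
    ∃ h : ℝ → ℝ, IsSolution H₁ H₂ T h ∧ (∀ u ∈ Ioc 0 T, SolvesAt H₁ H₂ T h u) ∧
      MemLp (fun t : ℝ => h t * t ^ (1 / 2 - H₁)) 2 (volume.restrict (Ioc 0 T)) ∧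
      ∀ g : ℝ → ℝ, IsSolution H₁ H₂ T g → g =ᵐ[volume.restrict (Ioc 0 T)] h := by
  have h₁' : H₁ < 1 := by linarith
  have h₂' : 1 / 2 < H₂ := by linarith
  have h₁₂ : H₁ < H₂ := by linarith
  have hd : H₂ < H₁ + 1 := by linarith
  set μ : Measure ℝ := volume.restrict (Ioc 0 T) with hμ
  -- The midpoint of 1 - 2d and 1/2, an interval that is nonempty precisely because d > 1/4.
  set p : ℝ := 3 / 4 - (H₂ - H₁) with hp
  obtain ⟨C, hC, hup⟩ := exists_weightedKernel_le h₁ h₁' h₂' h₂ h₁₂ (p := p)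
    (by linarith) (by linarith) hT
  obtain ⟨c, hc, hlow⟩ := exists_le_weightedKernel h₁ h₁' h₂' h₂ h₁₂ hT
  obtain ⟨M, hM, hrow⟩ := exists_lintegral_row_le (p := p) (by linarith) C T
  set κ : ℝ → ℝ → ℝ := weightedKernel H₁ H₂ with hκdef
  set q : ℝ → ℝ → ℝ := fun s u => C * (|0 - u| ^ (-p) + |s - u| ^ (-p)) with hq
  set w : ℝ → ℝ := fun s => s ^ (1 / 2 - H₁) with hw
  have hκm : Measurable fun z : ℝ × ℝ => κ z.1 z.2 := measurable_weightedKernel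
  have hqm : Measurable fun z : ℝ × ℝ => q z.1 z.2 := by simp only [hq]; fun_prop
  have hκ0 : ∀ s u, 0 ≤ κ s u := weightedKernel_nonneg h₁' h₂' h₂ h₁₂ hd
  have hmem : ∀ᵐ s ∂μ, s ∈ Ioc 0 T := ae_restrict_mem measurableSet_Ioc
  have hwL2 : MemLp w 2 μ := memLp_two_rpow (by linarith) T
  have hw0 : ∀ᵐ s ∂μ, 0 ≤ w s := by
    filter_upwards [hmem] with s hs using Real.rpow_nonneg hs.1.le _
  have hdom : ∀ s ∈ Ioc 0 T, ∀ u ∈ Ioc 0 T, s ≠ u → |κ s u| ≤ w s * q s u := by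
    intro s hs u hu hsu
    rw [abs_of_nonneg (hκ0 s u)]
    exact hup s u hs hu hsu
  have hrow' : ∀ᵐ s ∂μ, ∫⁻ u, ENNReal.ofReal (q s u) ^ 2 ∂μ ≤ M := by
    filter_upwards [hmem] with s hs using hrow s hs
  have hκ2 : MemLp (fun z : ℝ × ℝ => κ z.1 z.2) 2 (μ.prod μ) := by
    refine memLp_two_of_weighted hκm hwL2 hw0 ?_ hM hrow'
    filter_upwards [hmem] with s hs
    filter_upwards [hmem, ae_ne_restrict _ s] with u hu hus
    exact hdom s hs u hu hus.symm
  -- By symmetry of κ the weight can be put on the fixed variable u, where it is a constant. This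
  -- gives absolute convergence at every u, not just almost every u.
  have hκrow : ∀ u ∈ Ioc 0 T, MemLp (fun s => κ s u) 2 μ := by
    intro u hu
    have hqu : MemLp (fun s => q u s) 2 μ := by
      refine ⟨(hqm.comp (measurable_const.prodMk measurable_id)).aestronglyMeasurable, ?_⟩
      rw [eLpNorm_lt_top_iff_lintegral_rpow_enorm_lt_top (by norm_num) (by norm_num)]
      simp only [ENNReal.toReal_ofNat, ENNReal.rpow_ofNat]
      refine lt_of_le_of_lt (le_of_eq ?_) ((hrow u hu).trans_lt hM.lt_top)
      refine lintegral_congr fun s => ?_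
      rw [Real.enorm_eq_ofReal]
      exact mul_nonneg hC.le (add_nonneg (Real.rpow_nonneg (abs_nonneg _) _)
        (Real.rpow_nonneg (abs_nonneg _) _))
    refine (hqu.const_mul (w u)).mono'
      (hκm.comp (measurable_id.prodMk measurable_const)).aestronglyMeasurable ?_
    filter_upwards [hmem, ae_ne_restrict _ u] with s hs hsu
    rw [Real.norm_eq_abs, hκdef, weightedKernel_comm]
    exact hdom u hu s hs hsu.symm
  have hne : ∀ᵐ z ∂(μ.prod μ), z.1 ∈ Ioc 0 T ∧ z.2 ∈ Ioc 0 T ∧ z.1 ≠ z.2 := by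
    have hS : MeasurableSet {z : ℝ × ℝ | z.1 ≠ z.2} :=
      (measurableSet_eq_fun measurable_fst measurable_snd).compl
    have h3 : ∀ᵐ z ∂(μ.prod μ), z.1 ≠ z.2 := by
      rw [Measure.ae_prod_iff_ae_ae hS]
      refine ae_of_all _ fun s => ?_
      filter_upwards [ae_ne_restrict _ s] with u hu using hu.symm
    filter_upwards [Measure.quasiMeasurePreserving_fst.ae hmem,
      Measure.quasiMeasurePreserving_snd.ae hmem, h3] with z hz1 hz2 hz3 using ⟨hz1, hz2, hz3⟩
  have hpos : ∀ φ : ℝ → ℝ, MemLp φ 2 μ →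
      0 ≤ ∫ z, κ z.1 z.2 * (φ z.1 * φ z.2) ∂(μ.prod μ) := by
    intro φ hφ
    refine integral_kernel_nonneg_of_factorization (ν := volume) hκ2 measurable_kernelFactor
      (ae_of_all _ fun s v => kernelFactor_nonneg h₁' h₂' h₂ h₁₂ hd s v) ?_
      (ae_of_all _ fun z => rfl) hφ
    filter_upwards [hne] with z hz
    exact integrable_kernelFactor_mul h₁' h₂' h₂ h₁₂ hd hz.1.1 hz.2.1.1 hz.2.2
  have hγ : 0 < gammaH H₁ ^ 2 := pow_pos (gammaH_pos h₁ h₁') 2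
  set γ := gammaH H₁ ^ 2 with hγdef
  obtain ⟨ψ, hψ, hψeq⟩ := exists_memLp_integral_eq hκ2 hpos hγ (hwL2.const_mul γ)
  have hwinv : ∀ u ∈ Ioc 0 T, u ^ (H₁ - 1 / 2) * w u = 1 := by
    intro u hu
    simp only [hw]
    rw [← Real.rpow_add hu.1]; convert Real.rpow_zero u using 2; ring
  -- The L² solution ψ is only determined almost everywhere. Defining h by solving the equation for
  -- its value at u makes it hold at every u.
  set h : ℝ → ℝ := fun u => u ^ (H₁ - 1 / 2) * (w u - γ⁻¹ * ∫ s, ψ s * κ s u ∂μ) with hh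
  have hhw : ∀ u ∈ Ioc 0 T, h u * w u = w u - γ⁻¹ * ∫ s, ψ s * κ s u ∂μ := by
    intro u hu
    simp only [hh]
    linear_combination (w u - γ⁻¹ * ∫ s, ψ s * κ s u ∂μ) * hwinv u hu
  have hhψ : (fun u => h u * w u) =ᵐ[μ] ψ := by
    filter_upwards [hmem, hψeq] with u hu hequ
    rw [hhw u hu]
    field_simp
    linear_combination -hequ
  have hsol : ∀ u ∈ Ioc 0 T, SolvesAt H₁ H₂ T h u := by
    intro u hu
    rw [solvesAt_iff h₁' h₂' h₁₂ hd hu]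
    have hcongr : (fun s => h s * w s * κ s u) =ᵐ[μ] fun s => ψ s * κ s u := by
      filter_upwards [hhψ] with s hs
      rw [← hs]
    refine ⟨(hψ.integrable_mul (hκrow u hu)).congr hcongr.symm, ?_⟩
    change γ * w u = γ * (h u * w u) + ∫ s, h s * w s * κ s u ∂μ
    rw [integral_congr_ae hcongr, hhw u hu]
    field_simp
    ring
  have hhm : AEStronglyMeasurable h μ := by
    have h4 : AEStronglyMeasurable (fun s => s ^ (H₁ - 1 / 2) * ψ s) μ :=
      (Measurable.aestronglyMeasurable (by fun_prop)).mul hψ.1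
    refine h4.congr ?_
    filter_upwards [hmem, hhψ] with s hs hs'
    rw [← hs']
    linear_combination h s * hwinv s hs
  refine ⟨h, ⟨hhm, ?_⟩, hsol, (memLp_congr_ae hhψ).2 hψ, fun g hg => ?_⟩
  · filter_upwards [hmem] with u hu using hsol u hu
  obtain ⟨hgm, hgs⟩ := hg
  set φ : ℝ → ℝ := fun s => g s * w s with hφdef
  have hφm : AEStronglyMeasurable φ μ := hgm.mul hwL2.1
  have hφs : ∀ᵐ u ∂μ, u ∈ Ioc 0 T ∧ Integrable (fun s => φ s * κ s u) μ ∧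
      γ * w u = γ * φ u + ∫ s, φ s * κ s u ∂μ := by
    filter_upwards [hmem, hgs] with u hu hgu
    exact ⟨hu, (solvesAt_iff h₁' h₂' h₁₂ hd hu g).1 hgu⟩
  -- One point u where the integral converges suffices; it exists because (0,T] has positive
  -- measure.
  have hφw : Integrable (fun s => φ s * w s) μ := by
    have : NeZero μ := ⟨by
      rw [hμ, Ne, Measure.restrict_eq_zero, Real.volume_Ioc]
      simpa using hT⟩
    obtain ⟨u, hu, hi, -⟩ := hφs.exists
    have hcu : 0 < c * u ^ (H₁ - 1 / 2) := mul_pos hc (Real.rpow_pos_of_pos hu.1 _)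
    refine (hi.norm.const_mul (c * u ^ (H₁ - 1 / 2))⁻¹).mono' (hφm.mul hwL2.1) ?_
    filter_upwards [hmem, ae_ne_restrict _ u] with s hs hsu
    have h5 : c * (w s * u ^ (H₁ - 1 / 2)) ≤ κ s u := hlow s u hs hu hsu
    have hws : 0 ≤ w s := Real.rpow_nonneg hs.1.le _
    rw [norm_mul (φ s), norm_mul (φ s), Real.norm_of_nonneg hws, Real.norm_of_nonneg (hκ0 s u),
      le_inv_mul_iff₀ hcu]
    calc _ = ‖φ s‖ * (c * (w s * u ^ (H₁ - 1 / 2))) := by ring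
      _ ≤ _ := mul_le_mul_of_nonneg_left h5 (norm_nonneg _)
  have hKφ : MemLp (fun u => ∫ s, φ s * κ s u ∂μ) 2 μ := by
    refine memLp_integral_of_weighted hκm hqm ?_ hM hrow' hφm hw0 hφw
    filter_upwards [hmem] with u hu
    filter_upwards [hmem, ae_ne_restrict _ u] with s hs hsu
    exact hdom s hs u hu hsu
  -- Bootstrap: the equation expresses φ as w - γ⁻¹Kφ, and both terms are now in L².
  have hφ2 : MemLp φ 2 μ := by
    refine (memLp_congr_ae ?_).1 (hwL2.sub (hKφ.const_mul γ⁻¹))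
    filter_upwards [hφs] with u hu
    simp only [Pi.sub_apply]
    field_simp
    linear_combination hu.2.2
  have hzero : φ - ψ =ᵐ[μ] 0 := by
    refine ae_eq_zero_of_integral_eq_zero hκ2 hpos hγ (hφ2.sub hψ) ?_
    filter_upwards [hφs, hψeq] with u hu hequ
    simp only [Pi.sub_apply, sub_mul]
    have hψi : Integrable (fun s => ψ s * κ s u) μ := hψ.integrable_mul (hκrow u hu.1)
    rw [integral_sub hu.2.1 hψi]
    linear_combination -hequ - hu.2.2
  filter_upwards [hmem, hzero, hhψ] with u hu h6 h7
  simp only [Pi.sub_apply, Pi.zero_apply, hφdef] at h6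
  have hwu : w u ≠ 0 := (Real.rpow_pos_of_pos hu.1 _).ne'
  exact mul_right_cancel₀ hwu (by linear_combination h6 - h7)

end

end MixedFBM

theorem theorem2p3 (H₁ H₂ : ℝ) (hH₁ : 1 / 2 < H₁) (hH₁₂ : H₁ < H₂) (hH₂ : H₂ < 1)
    (hgap : 1 / 4 < H₂ - H₁) :
    ∃ T : ℕ → ℝ, (∀ n, 0 < T n) ∧ Tendsto T atTop atTop ∧
      ∀ n, ∃ h : ℝ → ℝ,
        MixedFBM.IsSolution H₁ H₂ (T n) h ∧
        (∀ u ∈ Ioc 0 (T n), MixedFBM.SolvesAt H₁ H₂ (T n) h u) ∧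
        MemLp (fun t : ℝ => h t * t ^ (1 / 2 - H₁)) 2 (volume.restrict (Ioc 0 (T n))) ∧
        ∀ g : ℝ → ℝ, MixedFBM.IsSolution H₁ H₂ (T n) g →
          g =ᵐ[volume.restrict (Ioc 0 (T n))] h := by
  -- Any positive sequence tending to infinity would do; the shift by one avoids T = 0.
  refine ⟨fun n => (n : ℝ) + 1, fun n => by positivity,
    tendsto_atTop_add_const_right _ _ tendsto_natCast_atTop_atTop, fun n => ?_⟩
  exact MixedFBM.exists_unique_solution hH₁ hH₂ hgap (by positivity)
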